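/- Let $V$ be a finite-dimensional real inner product space, let $\Phi\subset V$ be a (reduced) crystallographic root system spanning $V$, and let $E$ be a euclidean space with vector space $V$ and a chosen origin $o\in E$. For $\alpha\in\Phi$ let $r_\alpha$ be the orthogonal reflection of $V$ in $\alpha^\perp$, and for $\alpha\in\Phi$, $j\in\mathbb Z$ let $r_{\alpha,j}$ be the orthogonal reflection of $E$ in the affine hyperplane $\{y\in E : \langle y-o,\alpha\rangle=j\}$. Let $W_0$ be the spherical Coxeter group generated by the $r_\alpha$, let $W$ be the affine Coxeter group generated by $R=\{r_{\alpha,j} : \alpha\in\Phi,\ j\in\mathbb Z\}$, and let $p\colon W\twoheadrightarrow W_0$ be the homomorphism sending an isometry to its linear part, so that $p(r_{\alpha,j})=r_\alpha$. The set $R$ is the set of reflections of the Coxeter group $W$: if $S\subset R$ and $(W,S)$ is a Coxeter system, then $R$ is the set of all $W$-conjugates of elements of $S$. The reflection length $\ell_R(w)$ of $w\in W$ is the least $k\ge 0$ such that $w$ is a product of $k$ elements of $R$. The move-set of $w\in W$ is $\{\lambda\in V : w(y)=y+\lambda\text{ for some }y\in E\}$, and the move-set of $u\in W_0$ is $\{\mu\in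 V : u(\lambda)=\lambda+\mu\text{ for some }\lambda\in V\}$. A root space is a linear subspace of $V$ spanned by the roots it contains, and for $w$ in $W$ or in $W_0$ the dimension $\dim(w)$ is the minimal dimension of a root space containing the move-set of $w$. Theorem A (Formula). For every $w\in W$, $$\ell_R(w)=2\dim(w)-\dim(p(w))=2d+e,$$ where $e=\dim(p(w))$ and $d=\dim(w)-\dim(p(w))$. -/

import Mathlib

noncomputable section

namespace AffineReflectionLength

section ReflectionLength

variable {G : Type*} [Group G]

/-- The length of `w` with respect to `R`: the least `k` such that `w = r₁ r₂ ⋯ r_k` with all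
`r_i ∈ R`. -/
def reflectionLength (R : Set G) (w : G) : ℕ :=
  sInf {k : ℕ | ∃ l : List G, (∀ r ∈ l, r ∈ R) ∧ l.prod = w ∧ l.length = k}

end ReflectionLength

section Linear

variable {V : Type*} [NormedAddCommGroup V] [InnerProductSpace ℝ V]

/-- (Reduced) crystallographic root systems in a euclidean vector space `V`. -/
structure IsCrystallographicRootSystem (Φ : Set V) : Prop where
  finite : Φ.Finite
  span_eq_top : Submodule.span ℝ Φ = ⊤
  zero_notMem : (0 : V) ∉ Φ
  reduced : ∀ α ∈ Φ, ∀ c : ℝ, c • α ∈ Φ → c = 1 ∨ c = -1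
  reflection_mem : ∀ α ∈ Φ, ∀ β ∈ Φ, β - (2 * inner ℝ β α / inner ℝ α α) • α ∈ Φ
  integral : ∀ α ∈ Φ, ∀ β ∈ Φ, ∃ n : ℤ, 2 * inner ℝ β α / inner ℝ α α = (n : ℝ)

/-- The reflection `r_α` in the hyperplane through the origin orthogonal to `α`. -/
def linearReflection (α : V) : V ≃ₗᵢ[ℝ] V :=
  (Submodule.span ℝ {α})ᗮ.reflection

/-- The spherical Coxeter group `W₀`, generated by the reflections `r_α`, `α ∈ Φ`. -/
def sphericalGroup (Φ : Set V) : Subgroup (V ≃ₗᵢ[ℝ] V) :=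
  Subgroup.closure (linearReflection '' Φ)

/-- The move-set of an orthogonal transformation: the image of `g - 1`. -/
def linearMoveSet (g : V ≃ₗᵢ[ℝ] V) : Set V :=
  {μ | ∃ v : V, g v = v + μ}

/-- Root spaces: the subspaces spanned by the roots that they contain. -/
def IsRootSpace (Φ : Set V) (U : Submodule ℝ V) : Prop :=
  U = Submodule.span ℝ ((U : Set V) ∩ Φ)

/-- The root dimension of `A`: the minimal dimension of a root space that contains `A`. -/
def rootDim (Φ : Set V) (A : Set V) : ℕ :=
  sInf {n : ℕ | ∃ U : Submodule ℝ V, IsRootSpace Φ U ∧ A ⊆ U ∧ Module.finrank ℝ U = n}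

/-- The dimension of an element of the spherical Coxeter group. -/
def sphericalDim (Φ : Set V) (g : sphericalGroup Φ) : ℕ :=
  rootDim Φ (linearMoveSet (g : V ≃ₗᵢ[ℝ] V))

end Linear

section Affine

variable {V E : Type*} [NormedAddCommGroup V] [InnerProductSpace ℝ V]
  [MetricSpace E] [NormedAddTorsor V E]

/-- For `α ≠ 0`, the affine hyperplane `H_{α,j}` of solutions to `⟨v, α⟩ = j`, where the point `o`
serves as the origin; see `mem_hyperplane`. -/
def hyperplane (o : E) (α : V) (j : ℤ) : AffineSubspace ℝ E :=
  AffineSubspace.mk' (((j : ℝ) / inner ℝ α α) • α +ᵥ o) (Submodule.span ℝ {α})ᗮ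

theorem mem_hyperplane (o : E) {α : V} (hα : α ≠ 0) (j : ℤ) (y : E) :
    y ∈ hyperplane o α j ↔ inner ℝ (y -ᵥ o) α = (j : ℝ) := by
  have h : inner ℝ α α ≠ (0 : ℝ) := inner_self_ne_zero.mpr hα
  rw [hyperplane, AffineSubspace.mem_mk', Submodule.mem_orthogonal_singleton_iff_inner_left,
    vsub_vadd_eq_vsub_sub, inner_sub_left, real_inner_smul_left, div_mul_cancel₀ _ h, sub_eq_zero]

instance (o : E) (α : V) (j : ℤ) : Nonempty (hyperplane o α j) :=
  inferInstanceAs (Nonempty (AffineSubspace.mk' _ _))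

variable [FiniteDimensional ℝ V]

/-- The reflection `r_{α,j}` in the hyperplane `H_{α,j}`. -/
def affineReflection (o : E) (α : V) (j : ℤ) : E ≃ᵃⁱ[ℝ] E :=
  EuclideanGeometry.reflection (hyperplane o α j)

/-- The affine Coxeter group `W` of `Φ`, generated by all `r_{α,j}` with `α ∈ Φ`, `j ∈ ℤ`. -/
def affineGroup (Φ : Set V) (o : E) : Subgroup (E ≃ᵃⁱ[ℝ] E) :=
  Subgroup.closure {g | ∃ α ∈ Φ, ∃ j : ℤ, g = affineReflection o α j}

/-- The set `R = {r_{α,j}}` of reflections of `W`. -/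
def reflections (Φ : Set V) (o : E) : Set (affineGroup Φ o) :=
  {g | ∃ α ∈ Φ, ∃ j : ℤ, (g : E ≃ᵃⁱ[ℝ] E) = affineReflection o α j}

/-- Every element of `W` is a product of reflections, so its reflection length is the minimum of a
non-empty set. -/
theorem exists_factorization (Φ : Set V) (o : E) (w : affineGroup Φ o) :
    ∃ l : List (affineGroup Φ o), (∀ r ∈ l, r ∈ reflections Φ o) ∧ l.prod = w := by
  obtain ⟨g, hg⟩ := w
  have hinv : ∀ α : V, ∀ j : ℤ, (affineReflection o α j)⁻¹ = affineReflection o α j :=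
    fun α j => EuclideanGeometry.reflection_symm _
  refine Subgroup.closure_induction'' (p := fun g hg => ∃ l : List (affineGroup Φ o),
    (∀ r ∈ l, r ∈ reflections Φ o) ∧ l.prod = ⟨g, hg⟩) ?_ ?_ ?_ ?_ hg
  · exact fun x hx => ⟨[⟨x, Subgroup.subset_closure hx⟩],
      fun r hr => by rw [List.mem_singleton.mp hr]; exact hx, by simp⟩
  · rintro x ⟨α, hα, j, rfl⟩
    refine ⟨[⟨(affineReflection o α j)⁻¹,
      inv_mem (Subgroup.subset_closure ⟨α, hα, j, rfl⟩)⟩], ?_, by simp⟩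
    intro r hr
    rw [List.mem_singleton.mp hr]
    exact ⟨α, hα, j, hinv α j⟩
  · exact ⟨[], by simp, rfl⟩
  · rintro x y hx hy ⟨l, hl, hlx⟩ ⟨m, hm, hmy⟩
    refine ⟨l ++ m, ?_, by rw [List.prod_append, hlx, hmy]; rfl⟩
    intro r hr
    exact (List.mem_append.mp hr).elim (hl r) (hm r)

/-- The homomorphism sending an isometry of `E` to its linear part. -/
def linearPart : (E ≃ᵃⁱ[ℝ] E) →* (V ≃ₗᵢ[ℝ] V) where
  toFun g := g.linearIsometryEquiv
  map_one' := rfl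
  map_mul' _ _ := rfl

theorem linearPart_affineReflection (o : E) (α : V) (j : ℤ) :
    linearPart (affineReflection o α j) = linearReflection α := by
  ext v
  have hd : (hyperplane o α j).direction = (Submodule.span ℝ {α})ᗮ :=
    AffineSubspace.direction_mk' _ _
  obtain ⟨x, hx⟩ : Nonempty (hyperplane o α j) := inferInstance
  have h := (affineReflection o α j).map_vadd x v
  rw [affineReflection, EuclideanGeometry.reflection_apply_of_mem _ _ hx,
    EuclideanGeometry.reflection_apply_of_mem _ x hx, vsub_self, map_zero, zero_vadd,
    vadd_vsub, vadd_right_cancel_iff] at h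
  rw [linearReflection]
  simp only [hd] at h
  exact h.symm

/-- The projection `p : W → W₀`: the homomorphism with `p(r_{α,j}) = r_α`
(see `proj_reflection`), which sends an element of `W` to its linear part. -/
def proj (Φ : Set V) (o : E) : affineGroup Φ o →* sphericalGroup Φ :=
  (linearPart.comp (affineGroup Φ o).subtype).codRestrict (sphericalGroup Φ) (by
    rintro ⟨g, hg⟩
    have hle : affineGroup Φ o ≤ (sphericalGroup Φ).comap linearPart := by
      refine (Subgroup.closure_le _).mpr ?_
      rintro _ ⟨α, hα, j, rfl⟩
      change linearPart (affineReflection o α j) ∈ sphericalGroup Φ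
      rw [linearPart_affineReflection]
      exact Subgroup.subset_closure ⟨α, hα, rfl⟩
    exact hle hg)

theorem proj_reflection (Φ : Set V) (o : E) {α : V} {j : ℤ} (w : affineGroup Φ o)
    (hw : (w : E ≃ᵃⁱ[ℝ] E) = affineReflection o α j) :
    (proj Φ o w : V ≃ₗᵢ[ℝ] V) = linearReflection α := by
  rw [← linearPart_affineReflection o α j, ← hw]
  rfl

/-- The move-set of an isometry `g` of `E`: the set of all motions of points of `E`. -/
def moveSet (g : E ≃ᵃⁱ[ℝ] E) : Set V :=
  {μ | ∃ y : E, g y = μ +ᵥ y}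

/-- The dimension of an element of the affine Coxeter group. -/
def affineDim (Φ : Set V) (o : E) (w : affineGroup Φ o) : ℕ :=
  rootDim Φ (moveSet (w : E ≃ᵃⁱ[ℝ] E))

end Affine

end AffineReflectionLength

end

open AffineReflectionLength

/-! The formula is a pair of inequalities. Let `u` be the linear part of `w`. Lower bound. Multiply
reflections one at a time and let `U` be the span of their roots so far, which contains every motion
of the product. A root outside `U` raises `dim U` by one and forces the linear move-space to grow. A
root inside `U` lowers the dimension of that move-space by at most one. Hence `2 * dim U ≤ dim (u -
1)V + k` for a product of `k` reflections (`exists_isRootSpace_of_factorization`). Upper bound. An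
element with a fixed point is a product of `dim (u - 1)V` reflections, and `(u - 1)V` is itself a
root space, so that `e = dim (u - 1)V` (`exists_factorization_of_apply_eq`, Carter's lemma). For
general `w`, let `U` be a minimal root space containing the move-set. The vector `w o - o` lies in
the coroot lattice and in `U`, hence is an integral combination of coroots in `U`. Modulo the
coroots in `(u - 1)V`, only `d = dim U - e` coroots are needed, by a minimal-level argument adding
one dimension at a time (`exists_rootLattice_le`). A translation by a multiple of a coroot is a
product of two parallel reflections, so `2 * d` reflections reduce `w` to an element with a fixed
point, which costs `e` more. Carter's lemma and the identification of `R` with the reflections of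
the Coxeter group both rest on one geometric fact: in a locally finite reflection group, a point on
no mirror has trivial stabilizer (`eq_one_of_mem_closure_of_apply_eq`). -/

namespace AffineReflectionLength

open scoped RealInnerProductSpace

/-! ### Locally finite reflection groups: walls, exchange and point stabilizers -/

section Chambers

variable {V E : Type*} [NormedAddCommGroup V] [InnerProductSpace ℝ V]
  [MetricSpace E] [NormedAddTorsor V E]

/-- The isometry `t` is the reflection in the hyperplane through some point `p` with some
normal vector `α`. -/
def IsHyperplaneReflection (t : E ≃ᵃⁱ[ℝ] E) : Prop :=
  ∃ (α : V) (p : E), α ≠ 0 ∧ ∀ z, t z = -(2 * ⟪z -ᵥ p, α⟫ / ⟪α, α⟫) • α +ᵥ z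

namespace IsHyperplaneReflection

variable {t : E ≃ᵃⁱ[ℝ] E}

/-- With `f` an affine function vanishing on the mirror, the squares of the two distances differ by
a positive multiple of `f z * f z'`. The inequality of distances thus says that `z` and `z'` lie
strictly on the same side of the mirror, without reference to a normal vector. -/
theorem exists_sameSide (ht : IsHyperplaneReflection t) :
    ∃ f : E → ℝ, ∀ z z', dist z z' < dist z (t z') ↔ 0 < f z * f z' := by
  obtain ⟨α, p, hα, ht⟩ := ht
  refine ⟨fun z => ⟪z -ᵥ p, α⟫, fun z z' => ?_⟩
  have hpos : 0 < ⟪α, α⟫ := real_inner_self_pos.mpr hα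
  have key : dist z (t z') ^ 2 = dist z z' ^ 2 + 4 * (⟪z -ᵥ p, α⟫ * ⟪z' -ᵥ p, α⟫) / ⟪α, α⟫ := by
    rw [ht, dist_eq_norm_vsub V, dist_eq_norm_vsub V, vsub_vadd_eq_vsub_sub,
      ← real_inner_self_eq_norm_sq, ← real_inner_self_eq_norm_sq, ← vsub_sub_vsub_cancel_right z z' p]
    generalize z -ᵥ p = a
    generalize z' -ᵥ p = b
    simp only [inner_sub_left, inner_sub_right, real_inner_smul_left, real_inner_smul_right,
      real_inner_comm α b, real_inner_comm α a, real_inner_comm b a]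
    field_simp
    ring
  rw [← sq_lt_sq₀ dist_nonneg dist_nonneg, key, lt_add_iff_pos_right]
  constructor
  · intro h
    have := (div_pos_iff_of_pos_right hpos).mp h
    linarith
  · intro h
    positivity

theorem sameSide_trans (ht : IsHyperplaneReflection t) {x y z : E}
    (h₁ : dist x y < dist x (t y)) (h₂ : dist y z < dist y (t z)) :
    dist x z < dist x (t z) := by
  obtain ⟨f, hf⟩ := ht.exists_sameSide
  rw [hf] at *
  have h := mul_pos h₁ h₂
  by_contra hn
  push Not at hn
  nlinarith [mul_self_nonneg (f y)]

theorem apply_apply (ht : IsHyperplaneReflection t) (z : E) : t (t z) = z := by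
  obtain ⟨α, p, hα, ht⟩ := ht
  have hpos : ⟪α, α⟫ ≠ 0 := inner_self_ne_zero.mpr hα
  rw [ht (t z), ht z, vadd_vsub_assoc, vadd_vadd, inner_add_left, real_inner_smul_left, ← add_smul]
  convert zero_vadd V z
  convert zero_smul ℝ α
  field_simp
  ring

theorem mul_self (ht : IsHyperplaneReflection t) : t * t = 1 := by
  ext z
  exact ht.apply_apply z

theorem inv_eq (ht : IsHyperplaneReflection t) : t⁻¹ = t :=
  inv_eq_of_mul_eq_one_left ht.mul_self

/-- The motion of one moved point determines a reflection: it is a normal vector, and the mirror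
bisects the segment from `y` to `t y`. This replaces arbitrary normals by motions of a common base
point in what follows. -/
theorem apply_eq (ht : IsHyperplaneReflection t) {y : E} (hy : t y ≠ y) (z : E) :
    t z = (1 - 2 * ⟪z -ᵥ y, t y -ᵥ y⟫ / ⟪t y -ᵥ y, t y -ᵥ y⟫) • (t y -ᵥ y) +ᵥ z := by
  obtain ⟨α, p, hα, ht⟩ := ht
  have hpos : ⟪α, α⟫ ≠ 0 := inner_self_ne_zero.mpr hα
  have hx : t y -ᵥ y = -(2 * ⟪y -ᵥ p, α⟫ / ⟪α, α⟫) • α := by rw [ht, vadd_vsub]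
  have hb : ⟪y -ᵥ p, α⟫ ≠ 0 := by
    intro h
    apply hy
    rw [ht, h]
    simp
  rw [hx, ht z, ← vsub_sub_vsub_cancel_right z y p]
  congr 1
  rw [smul_smul]
  congr 1
  simp only [inner_sub_left, real_inner_smul_left, real_inner_smul_right]
  field_simp
  ring

theorem eq_of_apply_eq {t' : E ≃ᵃⁱ[ℝ] E} (ht : IsHyperplaneReflection t)
    (ht' : IsHyperplaneReflection t') {y : E} (hy : t y ≠ y) (h : t' y = t y) : t' = t := by
  ext z
  rw [ht.apply_eq hy, ht'.apply_eq (h.symm ▸ hy), h]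

theorem conj (ht : IsHyperplaneReflection t) (g : E ≃ᵃⁱ[ℝ] E) :
    IsHyperplaneReflection (g * t * g⁻¹) := by
  obtain ⟨α, p, hα, ht⟩ := ht
  refine ⟨g.linearIsometryEquiv α, g p, by simpa using hα, fun z => ?_⟩
  obtain ⟨w, rfl⟩ := g.surjective z
  have : (g * t * g⁻¹) (g w) = g (t w) := by
    simp [AffineIsometryEquiv.coe_mul, AffineIsometryEquiv.coe_inv]
  rw [this, ht, g.map_vadd, map_smul, ← g.map_vsub, LinearIsometryEquiv.inner_map_map,
    LinearIsometryEquiv.inner_map_map]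

/-- If `t'` moves `y` by a vector `x'` with `⟪x', x'⟫ ≤ ⟪x, x'⟫`, where `x` is the motion of `y`
under `t`, then both `t'` and its conjugate of `t` move `y` less far than `t`. -/
theorem dist_lt_of_inner_le {t' : E ≃ᵃⁱ[ℝ] E} (ht : IsHyperplaneReflection t)
    (ht' : IsHyperplaneReflection t') {y : E} (hy : t y ≠ y) (hy' : t' y ≠ y) (hne : t' ≠ t)
    (hle : ⟪t' y -ᵥ y, t' y -ᵥ y⟫ ≤ ⟪t y -ᵥ y, t' y -ᵥ y⟫) :
    dist y (t' y) < dist y (t y) ∧ dist y ((t' * t * t') y) < dist y (t y) := by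
  have hxne : t' y -ᵥ y ≠ t y -ᵥ y := fun h =>
    hne (ht.eq_of_apply_eq ht' hy (vsub_left_cancel h))
  have hz : (t' * t * t') y = t' (t (t' y)) := rfl
  -- Since `t'` is an isometric involution, the conjugate moves `y` as far as `t` moves `t' y`,
  -- which is `|1 - 2⟪x', x⟫ / ⟪x, x⟫| * ‖x‖`. The hypothesis and `x' ≠ x` give `0 < ⟪x', x⟫ < ⟪x,
  -- x⟫`, so the factor is less than one.
  have hd : dist y (t' (t (t' y))) = dist (t' y) (t (t' y)) := by
    rw [← t'.dist_map, ht'.apply_apply]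
  rw [hz, hd, dist_comm y (t' y), dist_comm y (t y), dist_comm (t' y) (t (t' y)), dist_eq_norm_vsub V, dist_eq_norm_vsub V,
    dist_eq_norm_vsub V, ht.apply_eq hy (t' y), vadd_vsub]
  have h1 : 0 < ⟪t' y -ᵥ y - (t y -ᵥ y), t' y -ᵥ y - (t y -ᵥ y)⟫ :=
    real_inner_self_pos.mpr (sub_ne_zero.mpr hxne)
  have h2 : 0 < ⟪t' y -ᵥ y, t' y -ᵥ y⟫ := real_inner_self_pos.mpr (vsub_ne_zero.mpr hy')
  have h3 : 0 < ⟪t y -ᵥ y, t y -ᵥ y⟫ := real_inner_self_pos.mpr (vsub_ne_zero.mpr hy)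
  have h4 : 0 < ‖t y -ᵥ y‖ := norm_pos_iff.mpr (vsub_ne_zero.mpr hy)
  generalize t' y -ᵥ y = x' at *
  generalize t y -ᵥ y = x at *
  have hc : ⟪x', x⟫ = ⟪x, x'⟫ := real_inner_comm x x'
  simp only [inner_sub_left, inner_sub_right, hc] at h1
  constructor
  · rw [← sq_lt_sq₀ (norm_nonneg _) (norm_nonneg _), ← real_inner_self_eq_norm_sq,
      ← real_inner_self_eq_norm_sq]
    linarith
  · rw [norm_smul]
    refine mul_lt_of_lt_one_left h4 ?_
    have h5 : 2 * ⟪x', x⟫ / ⟪x, x⟫ < 2 := by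
      rw [div_lt_iff₀ h3]
      linarith
    have h6 : 0 < 2 * ⟪x', x⟫ / ⟪x, x⟫ := by
      apply div_pos _ h3
      linarith
    rw [Real.norm_eq_abs, abs_lt]
    constructor <;> linarith

/-- If the hyperplane of `t'` separates `y` from `t y`, then `t` is conjugate by a reflection `s`,
which is `t'` or `t * t' * t`, such that `s` and the conjugate move `y` less far than `t`. -/
theorem exists_shorter {t' : E ≃ᵃⁱ[ℝ] E} (ht : IsHyperplaneReflection t)
    (ht' : IsHyperplaneReflection t') {y : E} (hy : t y ≠ y) (hy' : t' y ≠ y)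
    (hy'' : (t * t' * t) y ≠ y) (hne : t' ≠ t)
    (hsep : ¬ dist y (t y) < dist y (t' (t y))) :
    ∃ s, (s = t' ∨ s = t * t' * t) ∧ dist y (s y) < dist y (t y) ∧
      dist y ((s * t * s) y) < dist y (t y) := by
  by_cases hle : ⟪t' y -ᵥ y, t' y -ᵥ y⟫ ≤ ⟪t y -ᵥ y, t' y -ᵥ y⟫
  · exact ⟨t', Or.inl rfl, ht.dist_lt_of_inner_le ht' hy hy' hne hle⟩
  refine ⟨t * t' * t, Or.inr rfl, ?_⟩
  have ht'' : IsHyperplaneReflection (t * t' * t) := by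
    simpa only [ht.inv_eq] using ht'.conj t
  have hne' : t * t' * t ≠ t := by
    intro h
    apply hne
    have h' : t * (t * t' * t) * t = t * t * t := by rw [h]
    rw [← mul_assoc, ← mul_assoc, ht.mul_self, one_mul, mul_assoc, ht.mul_self, mul_one,
      one_mul] at h'
    exact h'
  refine ht.dist_lt_of_inner_le ht'' hy hy'' hne' ?_
  have h2 : 0 < ⟪t' y -ᵥ y, t' y -ᵥ y⟫ := real_inner_self_pos.mpr (vsub_ne_zero.mpr hy')
  have h3 : 0 < ⟪t y -ᵥ y, t y -ᵥ y⟫ := real_inner_self_pos.mpr (vsub_ne_zero.mpr hy)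
  set x := t y -ᵥ y with hx
  set x' := t' y -ᵥ y with hx'
  set m := 1 - 2 * ⟪x, x'⟫ / ⟪x', x'⟫ with hm
  have e1 : t' (t y) = m • x' +ᵥ t y := ht'.apply_eq hy' (t y)
  have e2 : (t * t' * t) y -ᵥ y = m • (x' - (2 * ⟪x', x⟫ / ⟪x, x⟫) • x) := by
    have hL : (t * t' * t) y = t (t' (t y)) := rfl
    have hty : t y -ᵥ y = x := rfl
    rw [hL, e1, ht.apply_eq hy, ← hx, vadd_vadd, vadd_vsub_assoc, vadd_vsub_assoc, hty,
      inner_add_left, real_inner_smul_left, smul_sub, smul_smul]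
    have : (1 - 2 * (m * ⟪x', x⟫ + ⟪x, x⟫) / ⟪x, x⟫) = -1 - m * (2 * ⟪x', x⟫ / ⟪x, x⟫) := by
      field_simp
      ring
    rw [this, sub_smul]
    module
  -- The squared distance from `y` to `t' (t y)` is `⟪x, x⟫ + m * ⟪x', x'⟫`, so failure of the
  -- strict inequality in `hsep` means `m ≤ 0`. The motion of `y` under `t * t' * t` is `m` times
  -- the mirror image of `x'` in the hyperplane orthogonal to `x`. After division by `m` the
  -- required inequality becomes `⟪x, x'⟫ ≤ ⟪x', x'⟫`, which holds in the remaining case.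
  have hm0 : m ≤ 0 := by
    by_contra hpos
    push Not at hpos
    apply hsep
    rw [e1, dist_comm y, dist_comm y, dist_eq_norm_vsub V, dist_eq_norm_vsub V, vadd_vsub_assoc,
      ← sq_lt_sq₀ (norm_nonneg _) (norm_nonneg _), ← real_inner_self_eq_norm_sq,
      ← real_inner_self_eq_norm_sq, ← hx]
    have : ⟪m • x' + x, m • x' + x⟫ = ⟪x, x⟫ + m * ⟪x', x'⟫ := by
      simp only [inner_add_left, inner_add_right, real_inner_smul_left, real_inner_smul_right,
        real_inner_comm x x']
      rw [real_inner_comm x x'] at *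
      rw [hm]
      field_simp
      ring
    rw [this]
    have := mul_pos hpos h2
    linarith
  rw [e2]
  have hms : m * ⟪x', x'⟫ = ⟪x', x'⟫ - 2 * ⟪x, x'⟫ := by
    rw [hm]
    field_simp
  have hl : ⟪m • (x' - (2 * ⟪x', x⟫ / ⟪x, x⟫) • x), m • (x' - (2 * ⟪x', x⟫ / ⟪x, x⟫) • x)⟫ =
      m * (m * ⟪x', x'⟫) := by
    simp only [inner_sub_left, inner_sub_right, real_inner_smul_left, real_inner_smul_right,
      real_inner_comm x x']
    field_simp
    ring
  have hr : ⟪x, m • (x' - (2 * ⟪x', x⟫ / ⟪x, x⟫) • x)⟫ = m * (-⟪x, x'⟫) := by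
    simp only [inner_sub_right, real_inner_smul_right, real_inner_comm x x']
    field_simp
    ring
  rw [hl, hr]
  refine mul_le_mul_of_nonpos_left ?_ hm0
  rw [hms]
  push Not at hle
  linarith

end IsHyperplaneReflection

/-- The elements of `T` whose hyperplane is the only one of `T` that separates `y` from its
image. -/
def wallReflections (T : Set (E ≃ᵃⁱ[ℝ] E)) (y : E) : Set (E ≃ᵃⁱ[ℝ] E) :=
  {s | s ∈ T ∧ ∀ t ∈ T, t ≠ s → dist y (s y) < dist y (t (s y))}

/-- Induction on the number of reflections moving `y` less far than `t` does, finite by local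
finiteness. If `t` is not a wall reflection, some mirror fails to keep `y` and `t y` on one side,
and `exists_shorter` gives `t = s * (s * t * s) * s` with both `s` and `s * t * s` moving `y` less
far. -/
theorem subset_closure_wallReflections {T : Set (E ≃ᵃⁱ[ℝ] E)}
    (hT : ∀ t ∈ T, IsHyperplaneReflection t) (hconj : ∀ s ∈ T, ∀ t ∈ T, s * t * s ∈ T) {y : E}
    (hfin : ∀ c : ℝ, {t ∈ T | dist y (t y) < c}.Finite) (hy : ∀ t ∈ T, t y ≠ y) :
    T ⊆ Subgroup.closure (wallReflections T y) := by
  suffices H : ∀ n : ℕ, ∀ t ∈ T, {s ∈ T | dist y (s y) < dist y (t y)}.ncard = n →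
      t ∈ Subgroup.closure (wallReflections T y) from fun t ht => H _ t ht rfl
  intro n
  induction n using Nat.strong_induction_on with
  | _ n ih =>
  intro t ht hn
  have step : ∀ s ∈ T, dist y (s y) < dist y (t y) →
      s ∈ Subgroup.closure (wallReflections T y) := by
    intro s hs hlt
    refine ih _ ?_ s hs rfl
    rw [← hn]
    refine Set.ncard_lt_ncard ⟨fun r hr => ⟨hr.1, hr.2.trans hlt⟩, fun h => ?_⟩ (hfin _)
    exact lt_irrefl _ (h ⟨hs, hlt⟩ : s ∈ T ∧ _).2
  by_cases hw : t ∈ wallReflections T y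
  · exact Subgroup.subset_closure hw
  have : ∃ t' ∈ T, t' ≠ t ∧ ¬ dist y (t y) < dist y (t' (t y)) := by
    by_contra hcon
    push Not at hcon
    exact hw ⟨ht, hcon⟩
  obtain ⟨t', ht', hne, hsep⟩ := this
  obtain ⟨s, hs, h1, h2⟩ := (hT t ht).exists_shorter (hT t' ht') (hy t ht) (hy t' ht')
    (hy _ (hconj t ht t' ht')) hne hsep
  have hsT : s ∈ T := by
    rcases hs with rfl | rfl
    exacts [ht', hconj t ht t' ht']
  have hss := (hT s hsT).mul_self
  have e : t = s * (s * t * s) * s := by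
    rw [← mul_assoc, ← mul_assoc, hss, one_mul, mul_assoc, hss, mul_one]
  rw [e]
  exact mul_mem (mul_mem (step s hsT h1) (step _ (hconj s hsT t ht) h2)) (step s hsT h1)

/-- The exchange condition for the reflections in the walls of a chamber. -/
theorem wallReflections_exchange {T : Set (E ≃ᵃⁱ[ℝ] E)}
    (hT : ∀ t ∈ T, IsHyperplaneReflection t) (hconj : ∀ s ∈ T, ∀ t ∈ T, s * t * s ∈ T) (y : E)
    (l : List (E ≃ᵃⁱ[ℝ] E)) (hl : ∀ s ∈ l, s ∈ wallReflections T y) :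
    ∀ t ∈ T, ¬ dist y (l.prod y) < dist y (t (l.prod y)) → t y ≠ y →
      ∃ l' : List (E ≃ᵃⁱ[ℝ] E), (∀ s ∈ l', s ∈ wallReflections T y) ∧ l'.length < l.length ∧
        t * l.prod = l'.prod := by
  induction l with
  | nil =>
    intro t _ h hy
    refine absurd ?_ h
    simpa using hy.symm
  | cons s m ih =>
    intro t ht h hy
    have hs : s ∈ wallReflections T y := hl s (by simp)
    have hss := hT s hs.1
    have hm : ∀ r ∈ m, r ∈ wallReflections T y := fun r hr => hl r (by simp [hr])
    by_cases hts : t = s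
    · subst hts
      exact ⟨m, hm, by simp, by rw [List.prod_cons, ← mul_assoc, hss.mul_self, one_mul]⟩
    -- The mirror of `t ≠ s` has `y` and `s y` on one side, so it cannot have `s y` and `s (m.prod
    -- y)` on one side. Applying `s`, the mirror of `s * t * s` does not have `y` and `m.prod y` on
    -- one side, and the induction hypothesis applies to `m` and `s * t * s`.
    have h1 : dist y (s y) < dist y (t (s y)) := hs.2 t ht hts
    have h2 : ¬ dist (s y) (s (m.prod y)) < dist (s y) (t (s (m.prod y))) := fun h' =>
      h ((hT t ht).sameSide_trans h1 (by simpa using h'))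
    have h3 : ¬ dist y (m.prod y) < dist y ((s * t * s) (m.prod y)) := by
      intro h'
      apply h2
      rw [s.dist_map]
      refine h'.trans_eq ?_
      rw [← s.dist_map]
      congr 1
      exact hss.apply_apply _
    obtain ⟨l', hl', hlen, hprod⟩ := ih hm (s * t * s) (hconj s hs.1 t ht) h3 (by
      intro hfix
      have h4 : t (s y) = s y := by
        have := congrArg s hfix
        rwa [show s ((s * t * s) y) = s (s (t (s y))) from rfl, hss.apply_apply] at this
      rw [h4] at h1
      exact lt_irrefl _ h1)
    refine ⟨s :: l', ?_, by simpa using hlen, ?_⟩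
    · intro r hr
      rcases List.mem_cons.mp hr with rfl | hr
      exacts [hs, hl' r hr]
    · rw [List.prod_cons, List.prod_cons, ← hprod]
      simp only [← mul_assoc, hss.mul_self, one_mul]

/-- In a locally finite group generated by reflections, a point on none of the hyperplanes has
trivial stabilizer. -/
theorem eq_one_of_mem_closure_of_apply_eq {T : Set (E ≃ᵃⁱ[ℝ] E)}
    (hT : ∀ t ∈ T, IsHyperplaneReflection t) (hconj : ∀ s ∈ T, ∀ t ∈ T, s * t * s ∈ T) {y : E}
    (hfin : ∀ c : ℝ, {t ∈ T | dist y (t y) < c}.Finite) (hy : ∀ t ∈ T, t y ≠ y)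
    {w : E ≃ᵃⁱ[ℝ] E} (hw : w ∈ Subgroup.closure T) (hwy : w y = y) : w = 1 := by
  have hw' : w ∈ Subgroup.closure (wallReflections T y) :=
    (Subgroup.closure_le _).mpr (subset_closure_wallReflections hT hconj hfin hy) hw
  have hex : ∃ n : ℕ, ∃ l : List (E ≃ᵃⁱ[ℝ] E), (∀ s ∈ l, s ∈ wallReflections T y) ∧
      l.prod = w ∧ l.length = n := by
    rw [← Subgroup.mem_toSubmonoid, Subgroup.closure_toSubmonoid] at hw'
    obtain ⟨l, hl, hlw⟩ := Submonoid.exists_list_of_mem_closure hw'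
    refine ⟨_, l, fun s hs => ?_, hlw, rfl⟩
    rcases hl s hs with h | h
    · exact h
    · have := (hT _ h.1).inv_eq
      rw [inv_inv] at this
      rw [this]
      exact h
  classical
  obtain ⟨l, hl, hlw, hlen⟩ := Nat.find_spec hex
  cases l with
  | nil => simpa using hlw.symm
  | cons s m =>
    exfalso
    have hs : s ∈ wallReflections T y := hl s (by simp)
    have hss := hT s hs.1
    have hmy : m.prod y = s y := by
      rw [List.prod_cons] at hlw
      have : s (m.prod y) = y := (congrArg (fun g : E ≃ᵃⁱ[ℝ] E => g y) hlw).trans hwy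
      rw [← this, hss.apply_apply, this]
    -- In a shortest word `s :: m` for `w`, the relation `w y = y` gives `m.prod y = s y`, which
    -- lies across the mirror of `s` from `y`. Exchange then rewrites `s * m.prod = w` as a word
    -- shorter than `m`, contradicting minimality.
    obtain ⟨l', hl', hlen', hprod⟩ := wallReflections_exchange hT hconj y m
      (fun r hr => hl r (by simp [hr])) s hs.1 (by
        rw [hmy, hss.apply_apply, dist_self]
        exact not_lt.mpr dist_nonneg) (hy s hs.1)
    refine Nat.find_min hex (m := l'.length) ?_ ⟨l', hl', ?_, rfl⟩
    · rw [← hlen, List.length_cons]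
      omega
    · rw [← hprod, ← hlw, List.prod_cons]

end Chambers

/-! ### Linear reflections and roots -/

section Linear

variable {V : Type*} [NormedAddCommGroup V] [InnerProductSpace ℝ V]

theorem linearReflection_apply (α v : V) :
    linearReflection α v = v - (2 * ⟪v, α⟫ / ⟪α, α⟫) • α := by
  rw [linearReflection, Submodule.reflection_orthogonal_apply, Submodule.reflection_singleton_apply,
    real_inner_comm, real_inner_self_eq_norm_sq]
  simp only [RCLike.ofReal_real_eq_id, id]
  module

namespace IsCrystallographicRootSystem

variable {Φ : Set V} {α β : V}

theorem ne_zero (hΦ : IsCrystallographicRootSystem Φ) (hα : α ∈ Φ) : α ≠ 0 :=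
  fun h => hΦ.zero_notMem (h ▸ hα)

theorem neg_mem (hΦ : IsCrystallographicRootSystem Φ) (hα : α ∈ Φ) : -α ∈ Φ := by
  have h := hΦ.reflection_mem α hα α hα
  have h0 : ⟪α, α⟫ ≠ 0 := inner_self_ne_zero.mpr (hΦ.ne_zero hα)
  rw [mul_div_assoc, div_self h0] at h
  convert h using 1
  module

theorem linearReflection_mem (hΦ : IsCrystallographicRootSystem Φ) (hα : α ∈ Φ) (hβ : β ∈ Φ) :
    linearReflection α β ∈ Φ := by
  rw [linearReflection_apply]
  exact hΦ.reflection_mem α hα β hβ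

end IsCrystallographicRootSystem

end Linear

/-! ### The reflections `r_{α,j}` and the reflections of a Coxeter system -/

section Affine

variable {V E : Type*} [NormedAddCommGroup V] [InnerProductSpace ℝ V]
  [MetricSpace E] [NormedAddTorsor V E]

/-- A nonempty affine subspace contains a point that lies on no hyperplane `H_{α,j}` but those that
contain the subspace. -/
theorem exists_generic {Φ : Set V} (o : E) (hfin : Φ.Finite) (A : AffineSubspace ℝ E) (hA : (A : Set E).Nonempty) :
    ∃ y ∈ A, ∀ α ∈ Φ, ∀ j : ℤ, ⟪y -ᵥ o, α⟫ = (j : ℝ) →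
      (∀ v ∈ A.direction, ⟪v, α⟫ = 0) ∧ ∀ z ∈ A, ⟪z -ᵥ o, α⟫ = (j : ℝ) := by
  obtain ⟨p, hp⟩ := hA
  -- A real vector space is not a finite union of proper subspaces; those to avoid are the traces on
  -- `A.direction` of the root hyperplanes that do not contain it.
  have hdir : ∃ v ∈ A.direction, ∀ α ∈ Φ, ⟪v, α⟫ = 0 → ∀ w ∈ A.direction, ⟪w, α⟫ = 0 := by
    let s : Set (Submodule ℝ A.direction) := (fun α : V =>
      ((Submodule.span ℝ {α})ᗮ).comap A.direction.subtype) '' Φ \ {⊤}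
    have hs : s.Finite := (hfin.image _).subset Set.sdiff_subset
    have hne := Subspace.biUnion_ne_univ_of_top_notMem (s := hs.toFinset) (by simp [s])
    obtain ⟨v, hv⟩ := (Set.ne_univ_iff_exists_notMem _).mp hne
    refine ⟨v, v.2, fun α hα h0 w hw => ?_⟩
    by_contra hwα
    apply hv
    refine Set.mem_biUnion (x := ((Submodule.span ℝ {α})ᗮ).comap A.direction.subtype) ?_ ?_
    · rw [Finset.mem_coe, Set.Finite.mem_toFinset]
      refine ⟨⟨α, hα, rfl⟩, fun htop => hwα ?_⟩
      have : (⟨w, hw⟩ : A.direction) ∈ ((Submodule.span ℝ {α})ᗮ).comap A.direction.subtype := by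
        rw [htop]
        trivial
      exact Submodule.mem_orthogonal_singleton_iff_inner_left.mp this
    · exact Submodule.mem_orthogonal_singleton_iff_inner_left.mpr h0
  obtain ⟨v, hv, hgen⟩ := hdir
  -- On the line through `p` in direction `v`, each transverse hyperplane excludes one parameter, so
  -- countably many parameters are excluded in all.
  have hcount : (⋃ α ∈ Φ, ⋃ j : ℤ,
      {s : ℝ | ⟪v, α⟫ ≠ 0 ∧ ⟪(s • v +ᵥ p) -ᵥ o, α⟫ = (j : ℝ)}).Countable := by
    refine hfin.countable.biUnion fun α _ => Set.countable_iUnion fun j => ?_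
    refine Set.Subsingleton.countable fun a ha b hb => ?_
    obtain ⟨h0, ha⟩ := ha
    obtain ⟨-, hb⟩ := hb
    rw [← hb, vadd_vsub_assoc, vadd_vsub_assoc, inner_add_left, inner_add_left, add_left_inj,
      real_inner_smul_left, real_inner_smul_left] at ha
    exact mul_right_cancel₀ h0 ha
  obtain ⟨s, hs⟩ := (Set.ne_univ_iff_exists_notMem _).mp
    (fun h => Cardinal.not_countable_real (h ▸ hcount))
  refine ⟨s • v +ᵥ p, A.vadd_mem_of_mem_direction (A.direction.smul_mem s hv) hp,
    fun α hα j hj => ?_⟩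
  have h0 : ⟪v, α⟫ = 0 := by
    by_contra h0
    exact hs (Set.mem_biUnion hα (Set.mem_iUnion.mpr ⟨j, h0, hj⟩))
  have hall := hgen α hα h0
  refine ⟨hall, fun z hz => ?_⟩
  have hdz : z -ᵥ (s • v +ᵥ p) ∈ A.direction := A.vsub_mem_direction hz
    (A.vadd_mem_of_mem_direction (A.direction.smul_mem s hv) hp)
  rw [← vsub_add_vsub_cancel z (s • v +ᵥ p) o, inner_add_left, hall _ hdz, hj, zero_add]

variable [FiniteDimensional ℝ V]

theorem affineReflection_apply (o : E) {α : V} (hα : α ≠ 0) (j : ℤ) (z : E) :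
    affineReflection o α j z = -(2 * (⟪z -ᵥ o, α⟫ - j) / ⟪α, α⟫) • α +ᵥ z := by
  have h0 : ⟪α, α⟫ ≠ 0 := inner_self_ne_zero.mpr hα
  have hp : (((j : ℝ) / ⟪α, α⟫) • α +ᵥ o) ∈ hyperplane o α j := AffineSubspace.self_mem_mk' _ _
  have hd : (hyperplane o α j).direction = (Submodule.span ℝ {α})ᗮ :=
    AffineSubspace.direction_mk' _ _
  rw [affineReflection, EuclideanGeometry.reflection_apply_of_mem _ _ hp]
  simp only [hd]
  change linearReflection α _ +ᵥ _ = _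
  rw [linearReflection_apply, ← vsub_eq_zero_iff_eq (G := V), ← vsub_sub_vsub_cancel_right _ _ o,
    vadd_vsub_assoc _ _ o, vadd_vsub_assoc _ z o, vadd_vsub, vsub_vadd_eq_vsub_sub]
  generalize z -ᵥ o = v
  simp only [inner_sub_left, real_inner_smul_left, div_mul_cancel₀ _ h0]
  module

theorem affineReflection_apply_eq_self_iff (o : E) {α : V} (hα : α ≠ 0) (j : ℤ) (z : E) :
    affineReflection o α j z = z ↔ ⟪z -ᵥ o, α⟫ = j := by
  have h0 : ⟪α, α⟫ ≠ 0 := inner_self_ne_zero.mpr hα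
  rw [affineReflection_apply o hα, ← vsub_eq_zero_iff_eq (G := V), vadd_vsub, smul_eq_zero_iff_left hα,
    neg_eq_zero, div_eq_zero_iff, or_iff_left h0, mul_eq_zero, or_iff_right two_ne_zero,
    sub_eq_zero]

theorem isHyperplaneReflection_affineReflection (o : E) {α : V} (hα : α ≠ 0) (j : ℤ) :
    IsHyperplaneReflection (affineReflection o α j) := by
  refine ⟨α, ((j : ℝ) / ⟪α, α⟫) • α +ᵥ o, hα, fun z => ?_⟩
  have h0 : ⟪α, α⟫ ≠ 0 := inner_self_ne_zero.mpr hα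
  rw [affineReflection_apply o hα, vsub_vadd_eq_vsub_sub, inner_sub_left, real_inner_smul_left,
    div_mul_cancel₀ _ h0]

/-- The reflections `r_{α,j}` as isometries of `E`. -/
def affineReflections (Φ : Set V) (o : E) : Set (E ≃ᵃⁱ[ℝ] E) :=
  {g | ∃ α ∈ Φ, ∃ j : ℤ, g = affineReflection o α j}

variable {Φ : Set V}

theorem isHyperplaneReflection_of_mem (hΦ : IsCrystallographicRootSystem Φ) (o : E)
    {t : E ≃ᵃⁱ[ℝ] E} (ht : t ∈ affineReflections Φ o) :
    IsHyperplaneReflection t := by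
  obtain ⟨α, hα, j, rfl⟩ := ht
  exact isHyperplaneReflection_affineReflection o (hΦ.ne_zero hα) j

theorem affineReflections_conj (hΦ : IsCrystallographicRootSystem Φ) (o : E)
    {s t : E ≃ᵃⁱ[ℝ] E} (hs : s ∈ affineReflections Φ o)
    (ht : t ∈ affineReflections Φ o) : s * t * s⁻¹ ∈ affineReflections Φ o := by
  rw [(isHyperplaneReflection_of_mem hΦ o hs).inv_eq]
  obtain ⟨β, hβ, k, rfl⟩ := hs
  obtain ⟨α, hα, j, rfl⟩ := ht
  have hα0 := hΦ.ne_zero hα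
  have hβ0 := hΦ.ne_zero hβ
  have hm := hΦ.linearReflection_mem hβ hα
  obtain ⟨n, hn⟩ := hΦ.integral β hβ α hα
  -- The reflection `r_{β,k}` has translation part `k` times the coroot of `β`, whose inner product
  -- with `α` is the Cartan integer `n`. This shifts the index by `k * n`.
  refine ⟨linearReflection β α, hm, j - k * n, ?_⟩
  ext z
  change affineReflection o β k (affineReflection o α j (affineReflection o β k z)) = _
  have ha : ⟪α, α⟫ ≠ 0 := inner_self_ne_zero.mpr hα0
  have hb : ⟪β, β⟫ ≠ 0 := inner_self_ne_zero.mpr hβ0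
  rw [affineReflection_apply o hα0, AffineIsometryEquiv.map_vadd,
    (isHyperplaneReflection_affineReflection o hβ0 k).apply_apply,
    affineReflection_apply o (hΦ.ne_zero hm), LinearIsometryEquiv.inner_map_map, map_smul,
    affineReflection_apply o hβ0]
  have hl : (affineReflection o β k).linearIsometryEquiv = linearReflection β :=
    linearPart_affineReflection o β k
  rw [hl, vadd_vsub_assoc, linearReflection_apply]
  congr 4
  generalize z -ᵥ o = v
  simp only [inner_add_left, inner_sub_right, real_inner_smul_left, real_inner_smul_right]
  push_cast
  rw [← hn, real_inner_comm β α]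
  field_simp
  ring

theorem finite_reflections_lt (hΦ : IsCrystallographicRootSystem Φ) (o : E)
    (y : E) (c : ℝ) :
    {t ∈ affineReflections Φ o | dist y (t y) < c}.Finite := by
  have hsub : {t ∈ affineReflections Φ o | dist y (t y) < c} ⊆
      ⋃ α ∈ Φ, (fun j : ℤ => affineReflection o α j) ''
        Set.Icc ⌊⟪y -ᵥ o, α⟫ - c * ‖α‖⌋ ⌈⟪y -ᵥ o, α⟫ + c * ‖α‖⌉ := by
    rintro _ ⟨⟨α, hα, j, rfl⟩, h⟩
    refine Set.mem_biUnion hα ⟨j, ?_, rfl⟩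
    have hα0 : 0 < ‖α‖ := norm_pos_iff.mpr (hΦ.ne_zero hα)
    rw [dist_comm, affineReflection_apply o (hΦ.ne_zero hα), dist_vadd_left, norm_smul, norm_neg,
      real_inner_self_eq_norm_sq, Real.norm_eq_abs, abs_div, abs_of_pos (pow_pos hα0 2),
      abs_mul, abs_two] at h
    have h2 : 2 * |⟪y -ᵥ o, α⟫ - j| < c * ‖α‖ := by
      have : 2 * |⟪y -ᵥ o, α⟫ - j| / ‖α‖ ^ 2 * ‖α‖ = 2 * |⟪y -ᵥ o, α⟫ - j| / ‖α‖ := by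
        field_simp
      rwa [this, div_lt_iff₀ hα0] at h
    have h3 : |⟪y -ᵥ o, α⟫ - j| < c * ‖α‖ := by
      linarith [abs_nonneg (⟪y -ᵥ o, α⟫ - j)]
    rw [abs_lt] at h3
    constructor
    · have h4 := Int.floor_le (⟪y -ᵥ o, α⟫ - c * ‖α‖)
      have h5 : (⌊⟪y -ᵥ o, α⟫ - c * ‖α‖⌋ : ℝ) ≤ j := by linarith
      exact_mod_cast h5
    · have h4 := Int.le_ceil (⟪y -ᵥ o, α⟫ + c * ‖α‖)
      have h5 : (j : ℝ) ≤ ⌈⟪y -ᵥ o, α⟫ + c * ‖α‖⌉ := by linarith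
      exact_mod_cast h5
  refine Set.Finite.subset ?_ hsub
  exact hΦ.finite.biUnion fun α _ => (Set.finite_Icc _ _).image _

/-- An isometry in the group generated by some of the reflections `r_{α,j}` is trivial if it fixes
a point that is fixed by none of these reflections. -/
theorem eq_one_of_apply_eq (hΦ : IsCrystallographicRootSystem Φ) (o : E)
    {T : Set (E ≃ᵃⁱ[ℝ] E)} (hT : T ⊆ affineReflections Φ o)
    (hconj : ∀ s ∈ T, ∀ t ∈ T, s * t * s⁻¹ ∈ T) {y : E} (hy : ∀ t ∈ T, t y ≠ y)
    {w : E ≃ᵃⁱ[ℝ] E} (hw : w ∈ Subgroup.closure T) (hwy : w y = y) : w = 1 := by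
  have hT' : ∀ t ∈ T, IsHyperplaneReflection t := fun t ht =>
    isHyperplaneReflection_of_mem hΦ o (hT ht)
  refine eq_one_of_mem_closure_of_apply_eq hT' (fun s hs t ht => ?_) (fun c => ?_) hy hw hwy
  · simpa only [(hT' s hs).inv_eq] using hconj s hs t ht
  · exact (finite_reflections_lt hΦ o y c).subset fun t ht => ⟨hT ht.1, ht.2⟩

theorem reflections_conj (hΦ : IsCrystallographicRootSystem Φ) (o : E)
    (g : affineGroup Φ o) {t : affineGroup Φ o} (ht : t ∈ reflections Φ o) :
    g * t * g⁻¹ ∈ reflections Φ o := by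
  obtain ⟨l, hl, rfl⟩ := exists_factorization Φ o g
  induction l with
  | nil => simpa using ht
  | cons s m ih =>
    have h := ih fun r hr => hl r (by simp [hr])
    have := affineReflections_conj hΦ o (hl s (by simp)) h
    rw [List.prod_cons, mul_inv_rev]
    have e : s * m.prod * t * (m.prod⁻¹ * s⁻¹) = s * (m.prod * t * m.prod⁻¹) * s⁻¹ := by group
    rw [e]
    exact this

/-- The conjugates of the simple reflections form a conjugation-stable generating set inside `R`. If
`r ∈ R` were not among them, a generic point of its mirror would lie on none of their mirrors,
because such a mirror would coincide with that of `r`. As `r` fixes this point, it would be trivial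
by the stabilizer theorem. -/
theorem isReflection_iff_mem_reflections (hΦ : IsCrystallographicRootSystem Φ) (o : E)
    {B : Type*} {M : CoxeterMatrix B}
    (cs : CoxeterSystem M (affineGroup Φ o)) (hcs : ∀ i, cs.simple i ∈ reflections Φ o) :
    {t | cs.IsReflection t} = reflections Φ o := by
  have hsub : {t | cs.IsReflection t} ⊆ reflections Φ o := by
    rintro _ ⟨g, i, rfl⟩
    exact reflections_conj hΦ o g (hcs i)
  refine hsub.antisymm fun r hr => ?_
  by_contra hnot
  obtain ⟨α, hα, j, hrα⟩ := hr
  have hα0 := hΦ.ne_zero hα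
  obtain ⟨y, hyA, hgen⟩ := exists_generic (Φ := Φ) o hΦ.finite (hyperplane o α j)
    (Set.nonempty_coe_sort.mp (inferInstanceAs (Nonempty (hyperplane o α j))))
  rw [mem_hyperplane o hα0] at hyA
  set T : Set (E ≃ᵃⁱ[ℝ] E) := (affineGroup Φ o).subtype '' {t | cs.IsReflection t} with hT
  have hTR : T ⊆ affineReflections Φ o := by
    rintro _ ⟨t, ht, rfl⟩
    exact hsub ht
  have hy : ∀ t ∈ T, t y ≠ y := by
    rintro _ ⟨t, ht, rfl⟩ hty
    obtain ⟨β, hβ, k, htβ⟩ := hsub ht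
    have hβ0 := hΦ.ne_zero hβ
    rw [Subgroup.subtype_apply, htβ, affineReflection_apply_eq_self_iff o hβ0] at hty
    obtain ⟨hdir, hcont⟩ := hgen β hβ k hty
    apply hnot
    suffices r = t by rwa [this]
    refine Subtype.ext ?_
    rw [hrα, htβ, affineReflection, affineReflection]
    have hle : (hyperplane o α j).direction ≤ (hyperplane o β k).direction := by
      intro v hv
      rw [hyperplane, AffineSubspace.direction_mk']
      exact Submodule.mem_orthogonal_singleton_iff_inner_left.mpr (hdir v hv)
    have hdim : ∀ {γ : V} (i : ℤ), γ ≠ 0 → Module.finrank ℝ (hyperplane o γ i).direction + 1 =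
        Module.finrank ℝ V := by
      intro γ i hγ
      rw [hyperplane, AffineSubspace.direction_mk', add_comm, ← finrank_span_singleton (K := ℝ) hγ]
      exact Submodule.finrank_add_finrank_orthogonal _
    have hdeq : (hyperplane o α j).direction = (hyperplane o β k).direction :=
      Submodule.eq_of_le_of_finrank_eq hle (by
        have := hdim j hα0
        have := hdim k hβ0
        omega)
    have heq : hyperplane o α j = hyperplane o β k :=
      AffineSubspace.ext_of_direction_eq hdeq ⟨y, (mem_hyperplane o hα0 j y).mpr hyA,
        (mem_hyperplane o hβ0 k y).mpr hty⟩
    simp only [heq]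
  have hconj : ∀ s ∈ T, ∀ t ∈ T, s * t * s⁻¹ ∈ T := by
    rintro _ ⟨s, hs, rfl⟩ _ ⟨t, ht, rfl⟩
    exact ⟨s * t * s⁻¹, ht.conj s, by simp⟩
  have hgenT : (r : E ≃ᵃⁱ[ℝ] E) ∈ Subgroup.closure T := by
    rw [hT, ← MonoidHom.map_closure]
    refine ⟨r, ?_, rfl⟩
    have : Set.range cs.simple ⊆ {t | cs.IsReflection t} := by
      rintro _ ⟨i, rfl⟩
      exact cs.isReflection_simple i
    have h := Subgroup.closure_mono this
    rw [cs.subgroup_closure_range_simple] at h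
    exact h trivial
  have h1 := eq_one_of_apply_eq hΦ o hTR hconj hy hgenT
    (by rw [hrα, affineReflection_apply_eq_self_iff o hα0, hyA])
  rw [hrα] at h1
  have h2 := congrArg linearPart h1
  rw [linearPart_affineReflection, map_one] at h2
  have h3 := congrArg (fun g : V ≃ₗᵢ[ℝ] V => g α) h2
  simp only [linearReflection, Submodule.reflection_orthogonalComplement_singleton_eq_neg] at h3
  have h4 : -α = α := h3
  have h5 : (2 : ℝ) • α = 0 := by rw [two_smul, ← neg_add_cancel α, h4]
  exact hα0 ((smul_eq_zero.mp h5).resolve_left two_ne_zero)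

end Affine

/-! ### Move-spaces, fixed spaces and root spaces -/

section Linear

variable {V : Type*} [NormedAddCommGroup V] [InnerProductSpace ℝ V]

/-- The move-set of an orthogonal transformation as a subspace. -/
def moveSpace (g : V ≃ₗᵢ[ℝ] V) : Submodule ℝ V :=
  LinearMap.range ((g.toLinearEquiv : V →ₗ[ℝ] V) - LinearMap.id)

/-- The subspace of vectors fixed by an orthogonal transformation. -/
def fixedSpace (g : V ≃ₗᵢ[ℝ] V) : Submodule ℝ V :=
  LinearMap.ker ((g.toLinearEquiv : V →ₗ[ℝ] V) - LinearMap.id)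

variable {g : V ≃ₗᵢ[ℝ] V} {v : V}

theorem mem_moveSpace : v ∈ moveSpace g ↔ ∃ a, g a - a = v := Iff.rfl

theorem mem_fixedSpace : v ∈ fixedSpace g ↔ g v = v := sub_eq_zero

theorem apply_sub_mem_moveSpace (g : V ≃ₗᵢ[ℝ] V) (v : V) : g v - v ∈ moveSpace g := ⟨v, rfl⟩

theorem coe_moveSpace (g : V ≃ₗᵢ[ℝ] V) : (moveSpace g : Set V) = linearMoveSet g := by
  ext v
  simp only [SetLike.mem_coe, mem_moveSpace, linearMoveSet, Set.mem_ofPred_eq, sub_eq_iff_eq_add']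

/-- For an isometry, `‖g v - v‖² = -2⟪g v - v, v⟫`, so a vector orthogonal to its own motion is
fixed. Conversely, `⟪g a, v⟫ = ⟪g a, g v⟫ = ⟪a, v⟫` for fixed `v`. -/
theorem orthogonal_moveSpace (g : V ≃ₗᵢ[ℝ] V) : (moveSpace g)ᗮ = fixedSpace g := by
  ext v
  rw [mem_fixedSpace, Submodule.mem_orthogonal]
  constructor
  · intro h
    have h1 := h _ (apply_sub_mem_moveSpace g v)
    rw [inner_sub_left] at h1
    rw [← sub_eq_zero, ← inner_self_eq_zero (𝕜 := ℝ), inner_sub_left, inner_sub_right,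
      inner_sub_right, LinearIsometryEquiv.inner_map_map, real_inner_comm]
    rw [real_inner_comm] at h1
    rw [real_inner_comm] at h1
    linarith [real_inner_comm v (g v)]
  · rintro h _ ⟨a, rfl⟩
    change ⟪g a - a, v⟫ = 0
    rw [inner_sub_left]
    nth_rewrite 1 [← h]
    rw [LinearIsometryEquiv.inner_map_map, sub_self]

theorem IsRootSpace.sup_span_singleton {Φ : Set V} {U : Submodule ℝ V} (hU : IsRootSpace Φ U) {α : V}
    (hα : α ∈ Φ) : IsRootSpace Φ (U ⊔ Submodule.span ℝ {α}) := by
  refine le_antisymm (sup_le ?_ ?_) (Submodule.span_le.mpr Set.inter_subset_left)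
  · rw [hU]
    refine Submodule.span_mono fun x hx => ⟨?_, hx.2⟩
    rw [← hU]
    exact Submodule.mem_sup_left hx.1
  · rw [Submodule.span_singleton_le_iff_mem]
    exact Submodule.subset_span
      ⟨Submodule.mem_sup_right (Submodule.mem_span_singleton_self α), hα⟩

theorem isRootSpace_bot (Φ : Set V) : IsRootSpace Φ (⊥ : Submodule ℝ V) :=
  le_antisymm bot_le (Submodule.span_le.mpr Set.inter_subset_left)

theorem IsCrystallographicRootSystem.isRootSpace_top {Φ : Set V}
    (hΦ : IsCrystallographicRootSystem Φ) : IsRootSpace Φ (⊤ : Submodule ℝ V) := by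
  rw [IsRootSpace, Submodule.top_coe, Set.univ_inter, hΦ.span_eq_top]

theorem linearReflection_apply_apply (α v : V) :
    linearReflection α (linearReflection α v) = v :=
  Submodule.reflection_reflection _ _

theorem exists_linearReflection_sub (α v : V) : ∃ c : ℝ, linearReflection α v - v = c • α := by
  refine ⟨-(2 * ⟪v, α⟫ / ⟪α, α⟫), ?_⟩
  rw [linearReflection_apply]
  module

theorem rootDim_le {Φ : Set V} {U : Submodule ℝ V} (hU : IsRootSpace Φ U) {A : Set V}
    (hA : A ⊆ U) : rootDim Φ A ≤ Module.finrank ℝ U :=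
  Nat.sInf_le ⟨U, hU, hA, rfl⟩

theorem exists_finrank_eq_rootDim {Φ : Set V} (hΦ : IsCrystallographicRootSystem Φ) (A : Set V) :
    ∃ U : Submodule ℝ V, IsRootSpace Φ U ∧ A ⊆ U ∧ Module.finrank ℝ U = rootDim Φ A :=
  Nat.sInf_mem (s := {n : ℕ | ∃ U : Submodule ℝ V, IsRootSpace Φ U ∧ A ⊆ U ∧
    Module.finrank ℝ U = n}) ⟨_, ⊤, hΦ.isRootSpace_top, by simp, rfl⟩

variable [FiniteDimensional ℝ V]

theorem orthogonal_fixedSpace (g : V ≃ₗᵢ[ℝ] V) : (fixedSpace g)ᗮ = moveSpace g := by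
  rw [← orthogonal_moveSpace, Submodule.orthogonal_orthogonal]

theorem finrank_moveSpace_add_finrank_fixedSpace (g : V ≃ₗᵢ[ℝ] V) :
    Module.finrank ℝ (moveSpace g) + Module.finrank ℝ (fixedSpace g) = Module.finrank ℝ V := by
  rw [← orthogonal_moveSpace]
  exact Submodule.finrank_add_finrank_orthogonal _

theorem finrank_moveSpace_lt_of_fixedSpace_lt {g h : V ≃ₗᵢ[ℝ] V} (hlt : fixedSpace g < fixedSpace h) :
    Module.finrank ℝ (moveSpace h) < Module.finrank ℝ (moveSpace g) := by
  have h1 := finrank_moveSpace_add_finrank_fixedSpace g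
  have h2 := finrank_moveSpace_add_finrank_fixedSpace h
  have h3 := Submodule.finrank_lt_finrank_of_lt hlt
  omega

theorem rootDim_coe {Φ : Set V} {U : Submodule ℝ V} (hU : IsRootSpace Φ U) :
    rootDim Φ (U : Set V) = Module.finrank ℝ U := by
  refine le_antisymm (Nat.sInf_le ⟨U, hU, subset_rfl, rfl⟩) ?_
  refine le_csInf ⟨_, U, hU, subset_rfl, rfl⟩ ?_
  rintro _ ⟨U', -, h, rfl⟩
  exact Submodule.finrank_mono h

end Linear

/-! ### Elements with a fixed point, and the lower bound -/

section Affine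

variable {V E : Type*} [NormedAddCommGroup V] [InnerProductSpace ℝ V]
  [MetricSpace E] [NormedAddTorsor V E] [FiniteDimensional ℝ V] {Φ : Set V}

theorem exists_affineReflection_vsub (o : E) {α : V} (hα : α ≠ 0) (j : ℤ) (z : E) :
    ∃ c : ℝ, affineReflection o α j z -ᵥ z = c • α :=
  ⟨_, by rw [affineReflection_apply o hα, vadd_vsub]⟩

/-- An element of `W` with a fixed point is the product of as many reflections as its linear part
has non-trivial dimensions, and its linear move-set is a root space. -/
theorem exists_factorization_of_apply_eq (hΦ : IsCrystallographicRootSystem Φ) (o : E)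
    (w : affineGroup Φ o) {z : E} (hz : (w : E ≃ᵃⁱ[ℝ] E) z = z) :
    IsRootSpace Φ (moveSpace (linearPart (w : E ≃ᵃⁱ[ℝ] E))) ∧
      ∃ l : List (affineGroup Φ o), (∀ r ∈ l, r ∈ reflections Φ o) ∧ l.prod = w ∧
        l.length ≤ Module.finrank ℝ (moveSpace (linearPart (w : E ≃ᵃⁱ[ℝ] E))) := by
  induction hn : Module.finrank ℝ (moveSpace (linearPart (w : E ≃ᵃⁱ[ℝ] E)))
    using Nat.strong_induction_on generalizing w with
  | _ n ih =>
  by_cases hw : w = 1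
  · subst hw
    refine ⟨?_, [], by simp, rfl, by simp⟩
    have : moveSpace (linearPart ((1 : affineGroup Φ o) : E ≃ᵃⁱ[ℝ] E)) = ⊥ := by
      refine (Submodule.eq_bot_iff _).mpr ?_
      rintro _ ⟨a, rfl⟩
      exact sub_self a
    rw [this]
    exact isRootSpace_bot Φ
  set u := linearPart (w : E ≃ᵃⁱ[ℝ] E) with hu
  -- A generic point of the fixed subspace of `w ≠ 1` lies on some mirror, by triviality of
  -- stabilizers off the mirrors. By genericity this mirror contains the whole fixed subspace, so
  -- its root is orthogonal to `fixedSpace u` and hence lies in `moveSpace u`.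
  obtain ⟨y, hyA, hgen⟩ := exists_generic (Φ := Φ) o hΦ.finite
    (AffineSubspace.mk' z (fixedSpace u)) ⟨z, AffineSubspace.self_mem_mk' _ _⟩
  have hwy : (w : E ≃ᵃⁱ[ℝ] E) y = y := by
    have h1 : u (y -ᵥ z) = y -ᵥ z := mem_fixedSpace.mp (AffineSubspace.mem_mk'.mp hyA)
    have h2 := (w : E ≃ᵃⁱ[ℝ] E).map_vadd z (y -ᵥ z)
    rwa [vsub_vadd, hz, show (w : E ≃ᵃⁱ[ℝ] E).linearIsometryEquiv (y -ᵥ z) = y -ᵥ z from h1,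
      vsub_vadd] at h2
  obtain ⟨α, hα, j, hfix⟩ : ∃ α ∈ Φ, ∃ j : ℤ, affineReflection o α j y = y := by
    by_contra hcon
    push Not at hcon
    apply hw
    refine Subtype.ext (eq_one_of_apply_eq hΦ o (T := affineReflections Φ o) subset_rfl
      (fun s hs t ht => affineReflections_conj hΦ o hs ht) ?_ w.2 hwy)
    rintro _ ⟨α, hα, j, rfl⟩
    exact hcon α hα j
  have hα0 := hΦ.ne_zero hα
  obtain ⟨hdir, hcont⟩ := hgen α hα j ((affineReflection_apply_eq_self_iff o hα0 j y).mp hfix)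
  rw [AffineSubspace.direction_mk'] at hdir
  have hαm : α ∈ moveSpace u := by
    rw [← orthogonal_fixedSpace, Submodule.mem_orthogonal]
    exact hdir
  have hzfix : affineReflection o α j z = z :=
    (affineReflection_apply_eq_self_iff o hα0 j z).mpr (hcont z (AffineSubspace.self_mem_mk' _ _))
  let r : affineGroup Φ o :=
    ⟨affineReflection o α j, Subgroup.subset_closure ⟨α, hα, j, rfl⟩⟩
  have hr : r ∈ reflections Φ o := ⟨α, hα, j, rfl⟩
  have hrr : r * r = 1 := Subtype.ext (isHyperplaneReflection_affineReflection o hα0 j).mul_self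
  have hlin : ∀ v, linearPart ((r * w : affineGroup Φ o) : E ≃ᵃⁱ[ℝ] E) v =
      linearReflection α (u v) := by
    intro v
    rw [Subgroup.coe_mul, map_mul, ← linearPart_affineReflection o α j]
    rfl
  set u' := linearPart ((r * w : affineGroup Φ o) : E ≃ᵃⁱ[ℝ] E) with hu'
  -- To see that the inclusion is strict, write `α = u a - a`. As `u a` and `a` have equal norm, the
  -- reflection in `α` carries `u a` to `a`, so `a` is fixed by `u'` but not by `u`.
  have hfixlt : fixedSpace u < fixedSpace u' := by
    refine lt_of_le_of_ne (fun v hv => ?_) fun heq => ?_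
    · rw [mem_fixedSpace, hlin, mem_fixedSpace.mp hv, linearReflection_apply, hdir v hv]
      simp
    · obtain ⟨a, ha⟩ := mem_moveSpace.mp hαm
      have h1 : a ∈ fixedSpace u' := by
        rw [mem_fixedSpace, hlin]
        have hrefl : linearReflection (u a - a) (u a) = a :=
          Submodule.reflection_sub (u.norm_map a)
        rwa [ha] at hrefl
      rw [← heq, mem_fixedSpace] at h1
      rw [h1, sub_self] at ha
      exact hα0 ha.symm
  have hlt := finrank_moveSpace_lt_of_fixedSpace_lt hfixlt
  obtain ⟨hroot, l, hl, hprod, hlen⟩ := ih _ (hn ▸ hlt) (r * w) (by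
    change affineReflection o α j ((w : E ≃ᵃⁱ[ℝ] E) z) = z
    rw [hz, hzfix]) rfl
  constructor
  · have heq : moveSpace u = moveSpace u' ⊔ Submodule.span ℝ {α} := by
      apply le_antisymm
      · rintro _ ⟨a, rfl⟩
        obtain ⟨c, hc⟩ := exists_linearReflection_sub α (u a)
        change u a - a ∈ _
        have : u a - a = (u' a - a) + (-c) • α := by
          rw [hlin, neg_smul, ← hc]
          abel
        rw [this]
        exact Submodule.add_mem_sup (apply_sub_mem_moveSpace _ _)
          (Submodule.smul_mem _ _ (Submodule.mem_span_singleton_self α))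
      · refine sup_le ?_ ((Submodule.span_singleton_le_iff_mem _ _).mpr hαm)
        rw [← orthogonal_fixedSpace, ← orthogonal_fixedSpace]
        exact Submodule.orthogonal_le hfixlt.le
    rw [heq]
    exact hroot.sup_span_singleton hα
  · refine ⟨r :: l, ?_, ?_, ?_⟩
    · intro s hs
      rcases List.mem_cons.mp hs with rfl | hs
      exacts [hr, hl s hs]
    · rw [List.prod_cons, hprod, ← mul_assoc, hrr, one_mul]
    · rw [← hu'] at hlen
      rw [List.length_cons]
      omega

/-- The reflections `r_{α,0}` fix `o` and generate a copy of `W₀` in `W`. Statements about linear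
parts thereby reduce to elements with a fixed point. -/
theorem exists_lift (hΦ : IsCrystallographicRootSystem Φ) (o : E) (u : sphericalGroup Φ) :
    ∃ w : affineGroup Φ o, (w : E ≃ᵃⁱ[ℝ] E) o = o ∧ proj Φ o w = u := by
  have hle : sphericalGroup Φ ≤ ((affineGroup Φ o ⊓
      { carrier := {g : E ≃ᵃⁱ[ℝ] E | g o = o}
        mul_mem' := fun {a b} (ha : a o = o) (hb : b o = o) => by
          change a (b o) = o
          rw [hb, ha]
        one_mem' := rfl
        inv_mem' := fun {a} (ha : a o = o) => by
          change a.symm o = o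
          rw [AffineIsometryEquiv.symm_apply_eq, ha] }).map linearPart) := by
    refine (Subgroup.closure_le _).mpr ?_
    rintro _ ⟨α, hα, rfl⟩
    refine ⟨affineReflection o α 0, ⟨Subgroup.subset_closure ⟨α, hα, 0, rfl⟩, ?_⟩,
      linearPart_affineReflection o α 0⟩
    exact (affineReflection_apply_eq_self_iff o (hΦ.ne_zero hα) 0 o).mpr (by simp)
  obtain ⟨g, ⟨hg, hgo⟩, hgu⟩ := hle u.2
  exact ⟨⟨g, hg⟩, hgo, Subtype.ext hgu⟩

theorem isRootSpace_moveSpace (hΦ : IsCrystallographicRootSystem Φ) (o : E)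
    (w : affineGroup Φ o) : IsRootSpace Φ (moveSpace (linearPart (w : E ≃ᵃⁱ[ℝ] E))) := by
  obtain ⟨w', hw', hproj⟩ := exists_lift hΦ o (proj Φ o w)
  have h := (exists_factorization_of_apply_eq hΦ o w' hw').1
  rwa [show linearPart (w' : E ≃ᵃⁱ[ℝ] E) = linearPart (w : E ≃ᵃⁱ[ℝ] E) from
    congrArg Subtype.val hproj] at h

theorem sphericalDim_proj (hΦ : IsCrystallographicRootSystem Φ) (o : E) (w : affineGroup Φ o) :
    sphericalDim Φ (proj Φ o w) =
      Module.finrank ℝ (moveSpace (linearPart (w : E ≃ᵃⁱ[ℝ] E))) := by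
  rw [← rootDim_coe (isRootSpace_moveSpace hΦ o w), coe_moveSpace]
  rfl

/-- The roots of a factorization of length `k` span a space of dimension at most half the sum of `k`
and the dimension of the linear move-set. -/
theorem exists_isRootSpace_of_factorization (hΦ : IsCrystallographicRootSystem Φ) (o : E)
    (l : List (affineGroup Φ o)) (hl : ∀ r ∈ l, r ∈ reflections Φ o) :
    ∃ U : Submodule ℝ V, IsRootSpace Φ U ∧ (∀ y, (l.prod : E ≃ᵃⁱ[ℝ] E) y -ᵥ y ∈ U) ∧
      2 * Module.finrank ℝ U ≤
        Module.finrank ℝ (moveSpace (linearPart (l.prod : E ≃ᵃⁱ[ℝ] E))) + l.length := by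
  induction l with
  | nil => exact ⟨⊥, isRootSpace_bot Φ, by simp, by simp⟩
  | cons r m ih =>
    obtain ⟨U, hU, hmove, hdim⟩ := ih fun s hs => hl s (by simp [hs])
    obtain ⟨α, hα, j, hrα⟩ := hl r (by simp)
    have hα0 := hΦ.ne_zero hα
    rw [List.prod_cons, List.length_cons]
    set w := m.prod
    set u := linearPart (w : E ≃ᵃⁱ[ℝ] E) with hu
    have hlin : ∀ v, linearPart ((r * w : affineGroup Φ o) : E ≃ᵃⁱ[ℝ] E) v =
        linearReflection α (u v) := by
      intro v
      rw [Subgroup.coe_mul, map_mul, ← linearPart_affineReflection o α j, hrα]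
      rfl
    set u' := linearPart ((r * w : affineGroup Φ o) : E ≃ᵃⁱ[ℝ] E) with hu'
    refine ⟨U ⊔ Submodule.span ℝ {α}, hU.sup_span_singleton hα, fun y => ?_, ?_⟩
    · change (r : E ≃ᵃⁱ[ℝ] E) ((w : E ≃ᵃⁱ[ℝ] E) y) -ᵥ y ∈ _
      obtain ⟨c, hc⟩ := exists_affineReflection_vsub o hα0 j ((w : E ≃ᵃⁱ[ℝ] E) y)
      rw [← vsub_add_vsub_cancel _ ((w : E ≃ᵃⁱ[ℝ] E) y) y, hrα, hc, add_comm]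
      exact Submodule.add_mem_sup (hmove y)
        (Submodule.smul_mem _ _ (Submodule.mem_span_singleton_self α))
    -- If `α ∈ U`, the left side is unchanged, while the linear move-space loses at most one
    -- dimension and the length grows by one. If `α ∉ U`, the left side grows by at most two, and so
    -- the move-space has to gain a dimension.
    · by_cases hαU : α ∈ U
      · rw [sup_eq_left.mpr ((Submodule.span_singleton_le_iff_mem _ _).mpr hαU)]
        have hle : moveSpace u ≤ moveSpace u' ⊔ Submodule.span ℝ {α} := by
          rintro _ ⟨a, rfl⟩
          obtain ⟨c, hc⟩ := exists_linearReflection_sub α (u a)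
          change u a - a ∈ _
          have : u a - a = (u' a - a) + (-c) • α := by
            rw [hlin, neg_smul, ← hc]
            abel
          rw [this]
          exact Submodule.add_mem_sup (apply_sub_mem_moveSpace _ _)
            (Submodule.smul_mem _ _ (Submodule.mem_span_singleton_self α))
        have h1 := Submodule.finrank_mono hle
        have h2 := Submodule.finrank_add_le_finrank_add_finrank (moveSpace u')
          (Submodule.span ℝ {α})
        rw [finrank_span_singleton (K := ℝ) hα0] at h2
        omega
      · have hmU : moveSpace u ≤ U := by
          rintro _ ⟨a, rfl⟩
          have h1 := U.sub_mem (hmove (a +ᵥ o)) (hmove o)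
          rw [AffineIsometryEquiv.map_vadd, vadd_vsub_vadd_comm, add_sub_cancel_right] at h1
          exact h1
        -- If `r_α (u v) = v`, then `u v - v` is a multiple of `α` lying in `moveSpace u ≤ U`. Since
        -- `α ∉ U`, it vanishes, so both `u` and `r_α` fix `v`.
        have hfix : ∀ v ∈ fixedSpace u', v ∈ fixedSpace u ∧ ⟪v, α⟫ = 0 := by
          intro v hv
          rw [mem_fixedSpace, hlin] at hv
          obtain ⟨c, hc⟩ := exists_linearReflection_sub α (u v)
          have h1 : u v - v = (-c) • α := by
            rw [neg_smul, ← hc, hv]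
            abel
          have h2 : u v = v := by
            by_contra hne
            have hc0 : -c ≠ 0 := fun h0 => hne (sub_eq_zero.mp (by rw [h1, h0, zero_smul]))
            apply hαU
            rw [← U.smul_mem_iff hc0, ← h1]
            exact hmU (apply_sub_mem_moveSpace u v)
          refine ⟨mem_fixedSpace.mpr h2, ?_⟩
          rw [h2, linearReflection_apply, sub_eq_self, smul_eq_zero, or_iff_left hα0,
            div_eq_zero_iff, or_iff_left (inner_self_ne_zero.mpr hα0), mul_eq_zero,
            or_iff_right two_ne_zero] at hv
          exact hv
        have hlt : fixedSpace u' < fixedSpace u := by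
          -- Equality would make `α` orthogonal to all of `fixedSpace u`, hence an element of
          -- `moveSpace u ≤ U`.
          refine lt_of_le_of_ne (fun v hv => (hfix v hv).1) fun heq => hαU (hmU ?_)
          rw [← orthogonal_fixedSpace, Submodule.mem_orthogonal]
          exact fun v hv => (hfix v (heq ▸ hv)).2
        have h1 := finrank_moveSpace_lt_of_fixedSpace_lt hlt
        have h2 := Submodule.finrank_add_le_finrank_add_finrank U (Submodule.span ℝ {α})
        rw [finrank_span_singleton (K := ℝ) hα0] at h2
        omega

theorem exists_length_eq_reflectionLength (Φ : Set V) (o : E) (w : affineGroup Φ o) :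
    ∃ l : List (affineGroup Φ o), (∀ r ∈ l, r ∈ reflections Φ o) ∧ l.prod = w ∧
      l.length = reflectionLength (reflections Φ o) w := by
  obtain ⟨l, hl, hw⟩ := exists_factorization Φ o w
  exact Nat.sInf_mem (s := {k : ℕ | ∃ l : List (affineGroup Φ o), (∀ r ∈ l, r ∈ reflections Φ o) ∧
    l.prod = w ∧ l.length = k}) ⟨_, l, hl, hw, rfl⟩

theorem two_mul_affineDim_le (hΦ : IsCrystallographicRootSystem Φ) (o : E)
    (w : affineGroup Φ o) :
    2 * affineDim Φ o w ≤ sphericalDim Φ (proj Φ o w) + reflectionLength (reflections Φ o) w := by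
  obtain ⟨l, hl, rfl, hlen⟩ := exists_length_eq_reflectionLength Φ o w
  obtain ⟨U, hU, hmove, hdim⟩ := exists_isRootSpace_of_factorization hΦ o l hl
  rw [← hlen, sphericalDim_proj hΦ]
  refine le_trans (Nat.mul_le_mul_left 2 (rootDim_le hU ?_)) hdim
  rintro μ ⟨y, hy⟩
  have h1 := hmove y
  rwa [hy, vadd_vsub] at h1

end Affine

/-! ### Lattices spanned by the roots in a root space -/

section Lattice

variable {V : Type*} [NormedAddCommGroup V] [InnerProductSpace ℝ V]

/-- The lattice spanned by the roots in a subspace. -/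
def rootLattice (Φ : Set V) (A : Submodule ℝ V) : AddSubgroup V :=
  AddSubgroup.closure ((A : Set V) ∩ Φ)

variable {Φ : Set V}

theorem mem_rootLattice {A : Submodule ℝ V} {α : V} (hA : α ∈ A) (hα : α ∈ Φ) :
    α ∈ rootLattice Φ A :=
  AddSubgroup.subset_closure ⟨hA, hα⟩

theorem rootLattice_le (Φ : Set V) (A : Submodule ℝ V) : rootLattice Φ A ≤ A.toAddSubgroup :=
  (AddSubgroup.closure_le _).mpr Set.inter_subset_left

/-- Both Cartan integers are positive. If one is `1`, a reflection yields `±(β - γ)`. If both are at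
least `2`, then `2⟪β, γ⟫` is at least `2⟪β, β⟫` and `2⟪γ, γ⟫`, whence `⟪β - γ, β - γ⟫ ≤ 0`. -/
theorem IsCrystallographicRootSystem.eq_or_sub_mem (hΦ : IsCrystallographicRootSystem Φ) {β γ : V}
    (hβ : β ∈ Φ) (hγ : γ ∈ Φ) (hpos : 0 < ⟪β, γ⟫) : β = γ ∨ β - γ ∈ Φ := by
  obtain ⟨m, hm⟩ := hΦ.integral γ hγ β hβ
  obtain ⟨n, hn⟩ := hΦ.integral β hβ γ hγ
  have hb : 0 < ⟪β, β⟫ := real_inner_self_pos.mpr (hΦ.ne_zero hβ)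
  have hc : 0 < ⟪γ, γ⟫ := real_inner_self_pos.mpr (hΦ.ne_zero hγ)
  have h1 := hΦ.reflection_mem γ hγ β hβ
  have h2 := hΦ.reflection_mem β hβ γ hγ
  rw [hm] at h1
  rw [hn] at h2
  rw [real_inner_comm β γ] at hn
  have hm0 : 0 < m := by
    have : (0 : ℝ) < m := by rw [← hm]; positivity
    exact_mod_cast this
  have hn0 : 0 < n := by
    have : (0 : ℝ) < n := by rw [← hn]; positivity
    exact_mod_cast this
  rw [div_eq_iff hc.ne'] at hm
  rw [div_eq_iff hb.ne'] at hn
  by_cases hm1 : m = 1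
  · right
    simpa [hm1] using h1
  by_cases hn1 : n = 1
  · right
    have h3 := hΦ.neg_mem h2
    simpa [hn1] using h3
  left
  have hm2 : (2 : ℝ) ≤ m := by exact_mod_cast (by omega : 2 ≤ m)
  have hn2 : (2 : ℝ) ≤ n := by exact_mod_cast (by omega : 2 ≤ n)
  rw [← sub_eq_zero, ← inner_self_eq_zero (𝕜 := ℝ)]
  refine le_antisymm ?_ real_inner_self_nonneg
  simp only [inner_sub_left, inner_sub_right, real_inner_comm β γ]
  nlinarith

/-- The roots that are congruent to `β` modulo the lattice spanned by the roots in `A`. -/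
def congruentRoots (Φ : Set V) (A : Submodule ℝ V) (β : V) : Set V :=
  {β' ∈ Φ | β' - β ∈ rootLattice Φ A}

theorem linearReflection_mem_congruentRoots (hΦ : IsCrystallographicRootSystem Φ)
    {A : Submodule ℝ V} {α β β' : V} (hα : α ∈ Φ) (hαA : α ∈ A) (h : β' ∈ congruentRoots Φ A β) :
    linearReflection α β' ∈ congruentRoots Φ A β := by
  refine ⟨hΦ.linearReflection_mem hα h.1, ?_⟩
  obtain ⟨n, hn⟩ := hΦ.integral α hα β' h.1
  rw [linearReflection_apply, hn, sub_right_comm, Int.cast_smul_eq_zsmul]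
  exact sub_mem h.2 (zsmul_mem (mem_rootLattice hαA hα) n)

/-- The roots congruent to `β` modulo a root space `A` have a sum orthogonal to `A`. -/
theorem inner_sum_congruentRoots (hΦ : IsCrystallographicRootSystem Φ) {A : Submodule ℝ V}
    (hA : IsRootSpace Φ A) {β : V} {s : Finset V} (hs : (s : Set V) = congruentRoots Φ A β) {a : V}
    (ha : a ∈ A) : ⟪∑ x ∈ s, x, a⟫ = 0 := by
  have hroot : ∀ α ∈ (A : Set V) ∩ Φ, ⟪∑ x ∈ s, x, α⟫ = 0 := by
    rintro α ⟨hαA, hα⟩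
    have hmem : ∀ x ∈ s, linearReflection α x ∈ s := fun x hx => by
      rw [← Finset.mem_coe, hs] at hx ⊢
      exact linearReflection_mem_congruentRoots hΦ hα hαA hx
    -- The reflection in a root of `A` permutes the congruence class and so fixes its sum.
    have hinv : linearReflection α (∑ x ∈ s, x) = ∑ x ∈ s, x := by
      rw [map_sum]
      exact Finset.sum_nbij' (linearReflection α) (linearReflection α) hmem hmem
        (fun x _ => linearReflection_apply_apply α x) (fun x _ => linearReflection_apply_apply α x)
        (fun _ _ => rfl)
    rw [linearReflection_apply, sub_eq_self, smul_eq_zero, or_iff_left (hΦ.ne_zero hα),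
      div_eq_zero_iff, or_iff_left (inner_self_ne_zero.mpr (hΦ.ne_zero hα)), mul_eq_zero,
      or_iff_right two_ne_zero] at hinv
    exact hinv
  rw [hA] at ha
  induction ha using Submodule.span_induction with
  | mem x hx => exact hroot x hx
  | zero => exact inner_zero_right _
  | add x y _ _ hx hy => rw [inner_add_right, hx, hy, add_zero]
  | smul c x _ hx => rw [real_inner_smul_right, hx, mul_zero]

/-- Let `B` be spanned by the root space `A` and a root. Modulo the lattice of the roots in `A`,
the lattice of the roots in `B` is generated by one root. -/
theorem exists_rootLattice_le (hΦ : IsCrystallographicRootSystem Φ) {A : Submodule ℝ V}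
    [FiniteDimensional ℝ V] (hA : IsRootSpace Φ A) {γ₀ : V} (hγ₀ : γ₀ ∈ Φ) (hγ₀A : γ₀ ∉ A) :
    ∃ γ ∈ Φ, γ ∉ A ∧ rootLattice Φ (A ⊔ Submodule.span ℝ {γ₀}) ≤
      rootLattice Φ A ⊔ AddSubgroup.zmultiples γ := by
  set B := A ⊔ Submodule.span ℝ {γ₀} with hB
  -- Here `ν` is the component of `γ₀` orthogonal to `A`. The level `⟪·, ν⟫` is constant on
  -- congruence classes in `B` and vanishes on `B` exactly along `A`.
  obtain ⟨p, hp, ν, hν, hpν⟩ := A.exists_add_mem_mem_orthogonal γ₀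
  have hν0 : ν ≠ 0 := by
    rintro rfl
    rw [add_zero] at hpν
    exact hγ₀A (hpν ▸ hp)
  have hνpos : 0 < ⟪ν, ν⟫ := real_inner_self_pos.mpr hν0
  have hAν : ∀ a ∈ A, ⟪a, ν⟫ = 0 := fun a ha => hν a ha
  have hdecomp : ∀ v ∈ B, ∃ a ∈ A, ∃ c : ℝ, v = a + c • ν ∧ ⟪v, ν⟫ = c * ⟪ν, ν⟫ := by
    intro v hv
    obtain ⟨a, ha, c, hc⟩ : ∃ a ∈ A, ∃ c : ℝ, a + c • γ₀ = v := by
      obtain ⟨a, ha, b, hb, hab⟩ := Submodule.mem_sup.mp hv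
      obtain ⟨c, rfl⟩ := Submodule.mem_span_singleton.mp hb
      exact ⟨a, ha, c, hab⟩
    refine ⟨a + c • p, A.add_mem ha (A.smul_mem c hp), c, ?_, ?_⟩
    · rw [← hc, hpν, smul_add, add_assoc]
    · rw [← hc, hpν, smul_add, inner_add_left, inner_add_left, hAν a ha,
        hAν _ (A.smul_mem c hp), real_inner_smul_left]
      ring
  have hzero : ∀ v ∈ B, ⟪v, ν⟫ = 0 → v ∈ A := by
    intro v hv h0
    obtain ⟨a, ha, c, rfl, hc⟩ := hdecomp v hv
    rw [h0, eq_comm, mul_eq_zero, or_iff_left hνpos.ne'] at hc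
    rwa [hc, zero_smul, add_zero]
  have hAB : A ≤ B := le_sup_left
  have hcong : ∀ {β β' : V}, β ∈ B → β' ∈ congruentRoots Φ A β → β' ∈ B ∧ ⟪β', ν⟫ = ⟪β, ν⟫ := by
    intro β β' hβ hβ'
    have h1 : β' - β ∈ A := rootLattice_le Φ A hβ'.2
    refine ⟨by simpa using B.add_mem (hAB h1) hβ, ?_⟩
    rw [← sub_eq_zero, ← inner_sub_left]
    exact hAν _ h1
  -- The sum over a class of positive level is orthogonal to `A`, hence a positive multiple of `ν`.
  -- Two such sums have positive inner product, so some pair of representatives does as well.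
  have hpair : ∀ β ∈ Φ, β ∈ B → 0 < ⟪β, ν⟫ → ∀ γ ∈ Φ, γ ∈ B → 0 < ⟪γ, ν⟫ →
      ∃ β' ∈ congruentRoots Φ A β, ∃ γ' ∈ congruentRoots Φ A γ, 0 < ⟪β', γ'⟫ := by
    have hsum : ∀ β ∈ Φ, β ∈ B → 0 < ⟪β, ν⟫ → ∀ s : Finset V,
        (s : Set V) = congruentRoots Φ A β → ∃ c : ℝ, 0 < c ∧ ∑ x ∈ s, x = c • ν := by
      intro β hβ hβB hpos s hs
      have hsB : ∑ x ∈ s, x ∈ B := B.sum_mem fun x hx => by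
        rw [← Finset.mem_coe, hs] at hx
        exact (hcong hβB hx).1
      obtain ⟨a, ha, c, hac, hc⟩ := hdecomp _ hsB
      have ha0 : a = 0 := by
        rw [← inner_self_eq_zero (𝕜 := ℝ)]
        have h := inner_sum_congruentRoots hΦ hA hs ha
        rwa [hac, inner_add_left, real_inner_smul_left, real_inner_comm a ν, hAν a ha, mul_zero,
          add_zero] at h
      refine ⟨c, ?_, by rw [hac, ha0, zero_add]⟩
      refine pos_of_mul_pos_left ?_ hνpos.le
      rw [← hc, sum_inner]
      refine Finset.sum_pos (fun x hx => ?_) ⟨β, ?_⟩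
      · rw [← Finset.mem_coe, hs] at hx
        rw [(hcong hβB hx).2]
        exact hpos
      · rw [← Finset.mem_coe, hs]
        exact ⟨hβ, by simp⟩
    intro β hβ hβB hβpos γ hγ hγB hγpos
    have hfin : ∀ δ, (congruentRoots Φ A δ).Finite := fun δ =>
      hΦ.finite.subset fun x hx => hx.1
    obtain ⟨c, hc, hcs⟩ := hsum β hβ hβB hβpos (hfin β).toFinset (hfin β).coe_toFinset
    obtain ⟨d, hd, hds⟩ := hsum γ hγ hγB hγpos (hfin γ).toFinset (hfin γ).coe_toFinset
    by_contra hcon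
    push Not at hcon
    have h1 : ⟪∑ x ∈ (hfin β).toFinset, x, ∑ x ∈ (hfin γ).toFinset, x⟫ ≤ 0 := by
      rw [sum_inner]
      refine Finset.sum_nonpos fun x hx => ?_
      rw [inner_sum]
      refine Finset.sum_nonpos fun y hy => ?_
      exact hcon x ((hfin β).mem_toFinset.mp hx) y ((hfin γ).mem_toFinset.mp hy)
    rw [hcs, hds, real_inner_smul_left, real_inner_smul_right] at h1
    have : 0 < c * (d * ⟪ν, ν⟫) := by positivity
    linarith
  set P : Set V := {β ∈ Φ | β ∈ B ∧ 0 < ⟪β, ν⟫} with hP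
  have hPfin : P.Finite := hΦ.finite.subset fun x hx => hx.1
  have hγ₀P : γ₀ ∈ P := by
    refine ⟨hγ₀, Submodule.mem_sup_right (Submodule.mem_span_singleton_self γ₀), ?_⟩
    rw [hpν, inner_add_left, hAν p hp, zero_add]
    exact hνpos
  -- The generator is a root of least positive level. For a counterexample `β` of least level,
  -- representatives `β'`, `γ'` with positive inner product have a difference that is zero or a
  -- root, of level `⟪β, ν⟫ - ⟪γ, ν⟫`. If this level is positive, minimality of `β` applies; if it
  -- is zero, the difference lies in `A`.
  obtain ⟨γ, ⟨hγ, hγB, hγpos⟩, hmin⟩ := Set.exists_min_image P (fun v => ⟪v, ν⟫) hPfin ⟨γ₀, hγ₀P⟩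
  refine ⟨γ, hγ, fun h => hγpos.ne' (hAν γ h), ?_⟩
  set L := rootLattice Φ A ⊔ AddSubgroup.zmultiples γ with hL
  have hAL : rootLattice Φ A ≤ L := le_sup_left
  have hγL : γ ∈ L := (le_sup_right : _ ≤ L) (AddSubgroup.mem_zmultiples γ)
  have hpos : ∀ β ∈ P, β ∈ L := by
    by_contra hcon
    push Not at hcon
    obtain ⟨β₀, hβ₀, hβ₀L⟩ := hcon
    obtain ⟨β, ⟨⟨hβ, hβB, hβpos⟩, hβL⟩, hβmin⟩ := Set.exists_min_image {β ∈ P | β ∉ L}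
      (fun v => ⟪v, ν⟫) (hPfin.subset fun x hx => hx.1) ⟨β₀, hβ₀, hβ₀L⟩
    obtain ⟨β', hβ', γ', hγ', hin⟩ := hpair β hβ hβB hβpos γ hγ hγB hγpos
    obtain ⟨hβ'B, hβ'ν⟩ := hcong hβB hβ'
    obtain ⟨hγ'B, hγ'ν⟩ := hcong hγB hγ'
    have hdiff : β' - γ' ∈ L := by
      rcases hΦ.eq_or_sub_mem hβ'.1 hγ'.1 hin with heq | hmem
      · rw [heq, sub_self]
        exact zero_mem _
      · have hv : ⟪β' - γ', ν⟫ = ⟪β, ν⟫ - ⟪γ, ν⟫ := by rw [inner_sub_left, hβ'ν, hγ'ν]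
        rcases (hmin β ⟨hβ, hβB, hβpos⟩).lt_or_eq with hlt | heq
        · by_contra hnot
          have := hβmin (β' - γ') ⟨⟨hmem, B.sub_mem hβ'B hγ'B, by linarith⟩, hnot⟩
          linarith
        · exact hAL (mem_rootLattice (hzero _ (B.sub_mem hβ'B hγ'B) (by linarith)) hmem)
    apply hβL
    have h1 : β = (β' - γ') + (γ' - γ) + γ - (β' - β) := by abel
    rw [h1]
    exact sub_mem (add_mem (add_mem hdiff (hAL hγ'.2)) hγL) (hAL hβ'.2)
  refine (AddSubgroup.closure_le _).mpr ?_
  rintro β ⟨hβB, hβ⟩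
  rcases lt_trichotomy ⟪β, ν⟫ 0 with h | h | h
  · have := hpos (-β) ⟨hΦ.neg_mem hβ, B.neg_mem hβB, by rw [inner_neg_left]; linarith⟩
    exact (neg_mem_iff (S := AddSubgroup V)).mp this
  · exact hAL (mem_rootLattice (hzero β hβB h) hβ)
  · exact hpos β ⟨hβ, hβB, h⟩

theorem exists_mem_notMem_of_lt {A U : Submodule ℝ V} (hU : IsRootSpace Φ U) (hlt : A < U) :
    ∃ γ ∈ Φ, γ ∈ U ∧ γ ∉ A := by
  by_contra hcon
  push Not at hcon
  refine hlt.not_ge ?_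
  rw [hU, Submodule.span_le]
  exact fun x hx => hcon x hx.2 hx.1

variable [FiniteDimensional ℝ V]

theorem finrank_sup_span_singleton {A : Submodule ℝ V} {γ : V} (hγ : γ ∉ A) :
    Module.finrank ℝ ↥(A ⊔ Submodule.span ℝ {γ}) = Module.finrank ℝ A + 1 := by
  have hγ0 : γ ≠ 0 := fun h => hγ (h ▸ A.zero_mem)
  have h1 := Submodule.finrank_add_le_finrank_add_finrank A (Submodule.span ℝ {γ})
  rw [finrank_span_singleton (K := ℝ) hγ0] at h1
  have h2 : A < A ⊔ Submodule.span ℝ {γ} := by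
    rw [left_lt_sup, Submodule.span_singleton_le_iff_mem]
    exact hγ
  have h3 := Submodule.finrank_lt_finrank_of_lt h2
  omega

/-- Lattice points in a root space are integral combinations of the roots in it. -/
theorem mem_rootLattice_of_mem (hΦ : IsCrystallographicRootSystem Φ) {A : Submodule ℝ V}
    (hA : IsRootSpace Φ A) {v : V} (hv : v ∈ AddSubgroup.closure Φ) (hvA : v ∈ A) :
    v ∈ rootLattice Φ A := by
  induction hn : Module.finrank ℝ V - Module.finrank ℝ A generalizing A with
  | zero =>
    have htop : A = ⊤ := by
      refine Submodule.eq_top_of_finrank_eq (le_antisymm A.finrank_le ?_)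
      omega
    rwa [rootLattice, htop, Submodule.top_coe, Set.univ_inter]
  | succ n ih =>
    have hlt : A < ⊤ := by
      refine lt_top_iff_ne_top.mpr ?_
      rintro rfl
      rw [finrank_top] at hn
      omega
    obtain ⟨γ₀, hγ₀, -, hγ₀A⟩ := exists_mem_notMem_of_lt hΦ.isRootSpace_top hlt
    have hB := ih (hA.sup_span_singleton hγ₀) (Submodule.mem_sup_left hvA) (by
      rw [finrank_sup_span_singleton hγ₀A]
      omega)
    -- Descending from `V` one dimension at a time, `v` is a lattice vector of `A` plus `k • γ` with
    -- `γ ∉ A`; membership of `v` in `A` forces `k = 0`.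
    obtain ⟨γ, hγ, hγA, hle⟩ := exists_rootLattice_le hΦ hA hγ₀ hγ₀A
    obtain ⟨μ, hμ, x, hx, rfl⟩ := AddSubgroup.mem_sup.mp (hle hB)
    obtain ⟨k, rfl⟩ := AddSubgroup.mem_zmultiples_iff.mp hx
    have hkA : k • γ ∈ A := (A.add_mem_iff_right (rootLattice_le Φ A hμ)).mp hvA
    have hk : k = 0 := by
      by_contra hk
      rw [← Int.cast_smul_eq_zsmul ℝ, A.smul_mem_iff (Int.cast_ne_zero.mpr hk)] at hkA
      exact hγA hkA
    rwa [hk, zero_smul, add_zero]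

/-- A lattice point in a root space `U` is congruent modulo the lattice of a smaller root space `A`
to an integral combination of `dim U - dim A` roots. -/
theorem exists_roots_sub_sum_mem (hΦ : IsCrystallographicRootSystem Φ) {A U : Submodule ℝ V}
    (hA : IsRootSpace Φ A) (hU : IsRootSpace Φ U) (hAU : A ≤ U) {v : V}
    (hv : v ∈ rootLattice Φ U) :
    ∃ l : List (V × ℤ), (∀ p ∈ l, p.1 ∈ Φ) ∧
      l.length + Module.finrank ℝ A = Module.finrank ℝ U ∧
      v - (l.map fun p => p.2 • p.1).sum ∈ rootLattice Φ A := by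
  induction hn : Module.finrank ℝ U - Module.finrank ℝ A generalizing A with
  | zero =>
    have heq : A = U := Submodule.eq_of_le_of_finrank_le hAU (by omega)
    subst heq
    exact ⟨[], by simp, by simp, by simpa using hv⟩
  | succ n ih =>
    have hlt : A < U := by
      refine lt_of_le_of_ne hAU ?_
      rintro rfl
      omega
    obtain ⟨γ₀, hγ₀, hγ₀U, hγ₀A⟩ := exists_mem_notMem_of_lt hU hlt
    have hdim := finrank_sup_span_singleton hγ₀A
    obtain ⟨l, hl, hlen, hsum⟩ := ih (hA.sup_span_singleton hγ₀)
      (sup_le hAU ((Submodule.span_singleton_le_iff_mem _ _).mpr hγ₀U)) (by omega)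
    obtain ⟨γ, hγ, -, hle⟩ := exists_rootLattice_le hΦ hA hγ₀ hγ₀A
    obtain ⟨μ, hμ, x, hx, hμx⟩ := AddSubgroup.mem_sup.mp (hle hsum)
    obtain ⟨k, rfl⟩ := AddSubgroup.mem_zmultiples_iff.mp hx
    refine ⟨(γ, k) :: l, ?_, ?_, ?_⟩
    · intro p hp
      rcases List.mem_cons.mp hp with rfl | hp
      exacts [hγ, hl p hp]
    · rw [List.length_cons]
      omega
    · rw [List.map_cons, List.sum_cons, sub_add_eq_sub_sub_swap, ← hμx, add_sub_cancel_right]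
      exact hμ

end Lattice

/-! ### The dual root system -/

section Coroots

variable {V : Type*} [NormedAddCommGroup V] [InnerProductSpace ℝ V]

/-- The coroot of `α`. -/
noncomputable def coroot (α : V) : V :=
  (2 / ⟪α, α⟫) • α

variable {Φ : Set V} {α β : V}

theorem coroot_mem_iff (hα : α ≠ 0) {U : Submodule ℝ V} : coroot α ∈ U ↔ α ∈ U :=
  U.smul_mem_iff (div_ne_zero two_ne_zero (inner_self_ne_zero.mpr hα))

theorem inner_coroot_coroot (hα : α ≠ 0) : ⟪coroot α, coroot α⟫ = 4 / ⟪α, α⟫ := by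
  have h0 : ⟪α, α⟫ ≠ 0 := inner_self_ne_zero.mpr hα
  rw [coroot, real_inner_smul_left, real_inner_smul_right]
  field_simp
  norm_num

theorem cartan_coroot (hα : α ≠ 0) (hβ : β ≠ 0) :
    2 * ⟪coroot β, coroot α⟫ / ⟪coroot α, coroot α⟫ = 2 * ⟪α, β⟫ / ⟪β, β⟫ := by
  have h0 : ⟪α, α⟫ ≠ 0 := inner_self_ne_zero.mpr hα
  have h1 : ⟪β, β⟫ ≠ 0 := inner_self_ne_zero.mpr hβ
  rw [inner_coroot_coroot hα, coroot, coroot, real_inner_smul_left, real_inner_smul_right,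
    real_inner_comm α β]
  field_simp
  ring

theorem coroot_linearReflection (hα : α ≠ 0) (β : V) :
    coroot (linearReflection α β) = linearReflection (coroot α) (coroot β) := by
  have h0 : ⟪α, α⟫ ≠ 0 := inner_self_ne_zero.mpr hα
  rw [coroot, LinearIsometryEquiv.inner_map_map, ← map_smul, ← coroot, linearReflection_apply,
    linearReflection_apply, inner_coroot_coroot hα]
  congr 1
  rw [coroot, coroot, real_inner_smul_right, smul_smul]
  congr 1
  field_simp
  ring

theorem coroot_coroot (hα : α ≠ 0) : coroot (coroot α) = α := by
  have h0 : ⟪α, α⟫ ≠ 0 := inner_self_ne_zero.mpr hα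
  rw [coroot, inner_coroot_coroot hα, coroot, smul_smul]
  convert one_smul ℝ α
  field_simp
  norm_num

theorem coroot_neg (α : V) : coroot (-α) = -coroot α := by
  rw [coroot, coroot, inner_neg_neg, smul_neg]

/-- Coroots are nonzero multiples of roots, so both systems have the same root spaces. The lattice
results, needed for the translations of `W`, can thus be applied to coroots without changing
dimensions. -/
theorem IsRootSpace.coroots (hΦ : IsCrystallographicRootSystem Φ) {U : Submodule ℝ V}
    (hU : IsRootSpace Φ U) : IsRootSpace (coroot '' Φ) U := by
  refine le_antisymm ?_ (Submodule.span_le.mpr Set.inter_subset_left)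
  conv_lhs => rw [hU]
  rw [Submodule.span_le]
  rintro α ⟨hαU, hα⟩
  have hα0 := hΦ.ne_zero hα
  rw [SetLike.mem_coe, ← coroot_mem_iff hα0]
  exact Submodule.subset_span ⟨(coroot_mem_iff hα0).mpr hαU, α, hα, rfl⟩

theorem IsCrystallographicRootSystem.coroots (hΦ : IsCrystallographicRootSystem Φ) :
    IsCrystallographicRootSystem (coroot '' Φ) where
  finite := hΦ.finite.image _
  span_eq_top := by
    have h := hΦ.isRootSpace_top.coroots hΦ
    rw [IsRootSpace, Submodule.top_coe, Set.univ_inter] at h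
    exact h.symm
  zero_notMem := by
    rintro ⟨α, hα, h⟩
    refine hΦ.ne_zero hα ?_
    rw [← coroot_coroot (hΦ.ne_zero hα), h, coroot, smul_zero]
  reduced := by
    rintro _ ⟨α, hα, rfl⟩ c ⟨β, hβ, h⟩
    have hα0 := hΦ.ne_zero hα
    have hβ0 := hΦ.ne_zero hβ
    have hcα : coroot α ≠ 0 := by
      rw [coroot]
      exact smul_ne_zero (div_ne_zero two_ne_zero (inner_self_ne_zero.mpr hα0)) hα0
    obtain ⟨d, hd⟩ : ∃ d : ℝ, β = d • α := by
      obtain ⟨k, hk⟩ : ∃ k : ℝ, β = k • coroot β := ⟨_, (coroot_coroot hβ0).symm⟩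
      rw [h, coroot, smul_smul, smul_smul] at hk
      exact ⟨_, hk⟩
    have hc : ∀ c' : ℝ, coroot β = c' • coroot α → c = c' := fun c' h' =>
      smul_left_injective ℝ hcα (h.symm.trans h')
    rcases hΦ.reduced α hα d (hd ▸ hβ) with rfl | rfl
    · exact Or.inl (hc 1 (by rw [hd, one_smul, one_smul]))
    · exact Or.inr (hc (-1) (by rw [hd, neg_one_smul, neg_one_smul, coroot_neg]))
  reflection_mem := by
    rintro _ ⟨α, hα, rfl⟩ _ ⟨β, hβ, rfl⟩
    rw [← linearReflection_apply, ← coroot_linearReflection (hΦ.ne_zero hα)]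
    exact ⟨_, hΦ.linearReflection_mem hα hβ, rfl⟩
  integral := by
    rintro _ ⟨α, hα, rfl⟩ _ ⟨β, hβ, rfl⟩
    rw [cartan_coroot (hΦ.ne_zero hα) (hΦ.ne_zero hβ)]
    exact hΦ.integral β hβ α hα

end Coroots

/-! ### Translation parts and the upper bound -/

section Affine

variable {V E : Type*} [NormedAddCommGroup V] [InnerProductSpace ℝ V]
  [MetricSpace E] [NormedAddTorsor V E] [FiniteDimensional ℝ V] {Φ : Set V}

theorem affineReflection_apply_eq_coroot (o : E) {α : V} (hα : α ≠ 0) (j : ℤ) (z : E) :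
    affineReflection o α j z = -(⟪z -ᵥ o, α⟫ - j) • coroot α +ᵥ z := by
  rw [affineReflection_apply o hα, coroot, smul_smul]
  congr 2
  ring

/-- The translation part of an element of `W` lies in the coroot lattice. -/
theorem apply_vsub_mem_closure_coroots (hΦ : IsCrystallographicRootSystem Φ) (o : E)
    (w : affineGroup Φ o) : (w : E ≃ᵃⁱ[ℝ] E) o -ᵥ o ∈ AddSubgroup.closure (coroot '' Φ) := by
  obtain ⟨l, hl, rfl⟩ := exists_factorization Φ o w
  induction l with
  | nil => simp
  | cons r m ih =>
    obtain ⟨α, hα, j, hrα⟩ := hl r (by simp)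
    have hm := ih fun s hs => hl s (by simp [hs])
    have hint : ∀ v ∈ AddSubgroup.closure (coroot '' Φ), ∃ n : ℤ, ⟪v, α⟫ = n := by
      intro v hv
      induction hv using AddSubgroup.closure_induction with
      | mem x hx =>
        obtain ⟨β, hβ, rfl⟩ := hx
        obtain ⟨n, hn⟩ := hΦ.integral β hβ α hα
        refine ⟨n, ?_⟩
        rw [← hn, coroot, real_inner_smul_left, real_inner_comm α β]
        ring
      | zero => exact ⟨0, by simp⟩
      | add x y _ _ hx hy =>
        obtain ⟨a, ha⟩ := hx
        obtain ⟨b, hb⟩ := hy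
        exact ⟨a + b, by rw [inner_add_left, ha, hb, Int.cast_add]⟩
      | neg x _ hx =>
        obtain ⟨a, ha⟩ := hx
        exact ⟨-a, by rw [inner_neg_left, ha, Int.cast_neg]⟩
    obtain ⟨n, hn⟩ := hint _ hm
    have h1 : ((r * m.prod : affineGroup Φ o) : E ≃ᵃⁱ[ℝ] E) o -ᵥ o =
        (-(n - j)) • coroot α + ((m.prod : E ≃ᵃⁱ[ℝ] E) o -ᵥ o) := by
      change (r : E ≃ᵃⁱ[ℝ] E) ((m.prod : E ≃ᵃⁱ[ℝ] E) o) -ᵥ o = _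
      rw [hrα, affineReflection_apply_eq_coroot o (hΦ.ne_zero hα), vadd_vsub_assoc, hn,
        ← Int.cast_smul_eq_zsmul ℝ]
      push_cast
      rfl
    rw [List.prod_cons, h1]
    exact add_mem (zsmul_mem (AddSubgroup.subset_closure (Set.mem_image_of_mem coroot hα)) _) hm

/-- If the translation part of `w` agrees with an integral combination of `n` coroots modulo the
linear move-set of `w`, then `w` is the product of `2 * n` reflections and an element of `W` with a
fixed point. -/
theorem exists_factorization_of_sub_sum_mem (hΦ : IsCrystallographicRootSystem Φ) (o : E)
    (l : List (V × ℤ)) (hl : ∀ p ∈ l, p.1 ∈ coroot '' Φ) (w : affineGroup Φ o)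
    (hw : (w : E ≃ᵃⁱ[ℝ] E) o -ᵥ o - (l.map fun p => p.2 • p.1).sum ∈
      moveSpace (linearPart (w : E ≃ᵃⁱ[ℝ] E))) :
    ∃ m : List (affineGroup Φ o), (∀ r ∈ m, r ∈ reflections Φ o) ∧ m.prod = w ∧
      m.length ≤
        2 * l.length + Module.finrank ℝ (moveSpace (linearPart (w : E ≃ᵃⁱ[ℝ] E))) := by
  induction l generalizing w with
  | nil =>
    rw [List.map_nil, List.sum_nil, sub_zero] at hw
    obtain ⟨a, ha⟩ := mem_moveSpace.mp hw
    -- If `w o - o = u a - a`, moving the base point by `-a` cancels the translation part.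
    have hfix : (w : E ≃ᵃⁱ[ℝ] E) (-a +ᵥ o) = -a +ᵥ o := by
      rw [AffineIsometryEquiv.map_vadd, map_neg, ← vsub_eq_zero_iff_eq (G := V), vadd_vsub_vadd_comm,
        ← ha]
      change -(linearPart (w : E ≃ᵃⁱ[ℝ] E) a) - -a + _ = 0
      abel
    simpa using (exists_factorization_of_apply_eq hΦ o w hfix).2
  | cons p l ih =>
    obtain ⟨⟨α, hα, hαp⟩, hl'⟩ := List.forall_mem_cons.mp hl
    have hα0 := hΦ.ne_zero hα
    let r : ℤ → affineGroup Φ o := fun j =>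
      ⟨affineReflection o α j, Subgroup.subset_closure ⟨α, hα, j, rfl⟩⟩
    have hr : ∀ j, r j ∈ reflections Φ o := fun j => ⟨α, hα, j, rfl⟩
    have hrr : ∀ j, r j * r j = 1 := fun j =>
      Subtype.ext (isHyperplaneReflection_affineReflection o hα0 j).mul_self
    have hlin : linearPart ((r 0 * (r p.2 * w) : affineGroup Φ o) : E ≃ᵃⁱ[ℝ] E) =
        linearPart (w : E ≃ᵃⁱ[ℝ] E) := by
      rw [Subgroup.coe_mul, Subgroup.coe_mul, map_mul, map_mul, linearPart_affineReflection,
        linearPart_affineReflection]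
      ext v
      exact linearReflection_apply_apply α _
    -- Reflections in parallel mirrors compose to a translation: `r_{α,0} r_{α,j}` is the
    -- translation by `-j` times the coroot of `α`. This removes one term of the sum and preserves
    -- the linear part.
    have happ : ((r 0 * (r p.2 * w) : affineGroup Φ o) : E ≃ᵃⁱ[ℝ] E) o =
        -(p.2 • p.1) +ᵥ (w : E ≃ᵃⁱ[ℝ] E) o := by
      have h0 : ⟪α, α⟫ ≠ 0 := inner_self_ne_zero.mpr hα0
      change affineReflection o α 0 (affineReflection o α p.2 ((w : E ≃ᵃⁱ[ℝ] E) o)) = _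
      generalize (w : E ≃ᵃⁱ[ℝ] E) o = z
      rw [affineReflection_apply_eq_coroot o hα0 p.2, affineReflection_apply_eq_coroot o hα0,
        vadd_vsub_assoc, vadd_vadd, inner_add_left, real_inner_smul_left, ← hαp, ← add_smul,
        ← Int.cast_smul_eq_zsmul ℝ, ← neg_smul]
      congr 2
      rw [coroot, real_inner_smul_left, div_mul_cancel₀ _ h0]
      push_cast
      ring
    obtain ⟨m, hm, hprod, hlen⟩ := ih hl' (r 0 * (r p.2 * w)) (by
      rw [hlin, happ, vadd_vsub_assoc]
      rw [List.map_cons, List.sum_cons] at hw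
      convert hw using 1
      abel)
    refine ⟨r p.2 :: r 0 :: m, ?_, ?_, ?_⟩
    · intro s hs
      rcases List.mem_cons.mp hs with rfl | hs
      · exact hr _
      rcases List.mem_cons.mp hs with rfl | hs
      exacts [hr _, hm s hs]
    · rw [List.prod_cons, List.prod_cons, hprod, ← mul_assoc (r 0), hrr, one_mul, ← mul_assoc, hrr,
        one_mul]
    · rw [hlin] at hlen
      rw [List.length_cons, List.length_cons, List.length_cons]
      omega

/-- The translation part `w o - o` lies in `U` and in the coroot lattice, hence in the lattice of
the coroots in `U`. Modulo the lattice of coroots in the linear move-space it is a combination of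
`d` coroots. This gives a factorization of length at most `2 * d + e`; adding `e` to both sides
avoids subtraction in `ℕ`. -/
theorem reflectionLength_add_sphericalDim_le (hΦ : IsCrystallographicRootSystem Φ) (o : E)
    (w : affineGroup Φ o) :
    reflectionLength (reflections Φ o) w + sphericalDim Φ (proj Φ o w) ≤ 2 * affineDim Φ o w := by
  obtain ⟨U, hU, hmove, hdim⟩ := exists_finrank_eq_rootDim hΦ (moveSet (w : E ≃ᵃⁱ[ℝ] E))
  have hwU : ∀ y, (w : E ≃ᵃⁱ[ℝ] E) y -ᵥ y ∈ U := fun y => hmove ⟨y, (vsub_vadd _ _).symm⟩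
  have hmU : moveSpace (linearPart (w : E ≃ᵃⁱ[ℝ] E)) ≤ U := by
    rintro _ ⟨a, rfl⟩
    have h1 := U.sub_mem (hwU (a +ᵥ o)) (hwU o)
    rw [AffineIsometryEquiv.map_vadd, vadd_vsub_vadd_comm, add_sub_cancel_right] at h1
    exact h1
  obtain ⟨l, hl, hlen, hsum⟩ := exists_roots_sub_sum_mem hΦ.coroots
    ((isRootSpace_moveSpace hΦ o w).coroots hΦ) (hU.coroots hΦ) hmU
    (mem_rootLattice_of_mem hΦ.coroots (hU.coroots hΦ) (apply_vsub_mem_closure_coroots hΦ o w)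
      (hwU o))
  obtain ⟨m, hm, hprod, hmlen⟩ := exists_factorization_of_sub_sum_mem hΦ o l hl w
    (rootLattice_le _ _ hsum)
  have h1 : reflectionLength (reflections Φ o) w ≤ m.length := Nat.sInf_le ⟨m, hm, hprod, rfl⟩
  rw [sphericalDim_proj hΦ, affineDim, ← hdim]
  omega

end Affine

end AffineReflectionLength

theorem theoremA {V : Type*} {E : Type*} [NormedAddCommGroup V] [InnerProductSpace ℝ V]
    [FiniteDimensional ℝ V] [MetricSpace E] [NormedAddTorsor V E]
    (Φ : Set V) (hΦ : IsCrystallographicRootSystem Φ) (o : E) :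
    -- `R` is the set of reflections of `W` as a Coxeter group
    (∀ (B : Type*) (M : CoxeterMatrix B)
        (cs : CoxeterSystem M (affineGroup Φ o)),
      (∀ i : B, cs.simple i ∈ reflections Φ o) →
        {t | cs.IsReflection t} = reflections Φ o) ∧
    -- the formula
    ∀ (w : affineGroup Φ o) (e d : ℤ),
      e = sphericalDim Φ (proj Φ o w) →
      d = affineDim Φ o w -
        sphericalDim Φ (proj Φ o w) →
      (reflectionLength (reflections Φ o) w : ℤ) =
          2 * affineDim Φ o w -
            sphericalDim Φ (proj Φ o w) ∧
        (reflectionLength (reflections Φ o) w : ℤ) =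
          2 * d + e := by
  refine ⟨fun B M cs hcs => isReflection_iff_mem_reflections hΦ o cs hcs, fun w e d he hd => ?_⟩
  have h1 := two_mul_affineDim_le hΦ o w
  have h2 := reflectionLength_add_sphericalDim_le hΦ o w
  constructor <;> omega
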